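/- **Setting.** Let $\mathcal M$ be a Polish space with a finite Borel reference measure $\nu$, let $\ell$ be Lebesgue measure on $\mathbb R^d$, and write $B(a,r)$ for closed balls. Let $Y$ be a marked point process on $\mathbb R^d$ with marks in $\mathcal M$ whose ground process is simple and locally finite. Assume that the moment measures of all orders exist, that is, $\mathbb E[Y(B\times\mathcal M)^n]<\infty$ for all $n$ and all bounded $B$, and that for every $n\ge 1$ there is a product density $\rho^{(n)}$, a finite-valued measurable function with $$\mathbb E\Big[\sum^{\neq}_{x_1,\dots,x_n\in Y} f(x_1,\dots,x_n)\Big]=\int f\,\rho^{(n)}\,d(\ell\otimes\nu)^n\quad\text{for all measurable } f\ge 0 .$$ Put $\lambda=\rho^{(1)}$. The correlation functions $\xi_n$ are defined by $\xi_1\equiv 1$ and, for $n\ge 2$, $$\sum_{\{E_1,\dots,E_k\}}\prod_{j=1}^k \xi_{|E_j|}(\{x_i: i\in E_j\})=\frac{\rho^{(n)}(x_1,\dots,x_n)}{\lambda(x_1)\cdots\lambda(x_n)},$$ the sum running over all partitions of $\{1,\dots,n\}$ into non-empty blocks. Assume that $Y$ is intensity-reweighted moment stationary (IRMS): $\inf_{\mathbb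 R^d\times\mathcal M}\lambda>0$, and for all $n\ge2$ and $a\in\mathbb R^d$ one has $\xi_n((z_1+a,m_1),\dots,(z_n+a,m_n))=\xi_n((z_1,m_1),\dots,(z_n,m_n))$ for $(\ell\otimes\nu)^n$-almost all arguments. Let $P^{!(z,m)}$ (expectation $\mathbb E^{!(z,m)}$) be reduced Palm measures of $Y$: a Markov kernel such that $\mathbb E\sum_{x\in Y}f(x,Y\setminus\{x\})=\int \mathbb E^{!x}[f(x,Y)]\,\lambda(x)\,(\ell\otimes\nu)(dx)$ for all measurable $f\ge0$. Let $C,D\subseteq\mathcal M$ be Borel with $\nu(C),\nu(D)>0$, put $\bar\lambda_D=\inf_{\mathbb R^d\times D}\lambda$ and $u_r^{a,D}(z,m)=\bar\lambda_D\mathbf 1\{(z,m)\in B(a,r)\times D\}/\lambda(z,m)$. For $a\in\mathbb R^d$, $r\ge 0$, $n\ge1$ define $$J_n^{CD}(r)=J_n^{CD}(r;a)=\int_C\int_{(B(0,r)\times D)^n}\xi_{n+1}\big((a,b),(z_1+a,m_1),\dots,(z_n+a,m_n)\big)\,\prod_{i=1}^n dz_i\,d\nu(m_i)\,d\nu(b),$$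 $$J_{\rm inhom}^{CD}(r;a)=\frac1{\nu(C)}\Big(\nu(C)+\sum_{n\ge1}\frac{(-\bar\lambda_D)^n}{n!}J_n^{CD}(r;a)\Big)\quad\text{whenever the series converges absolutely,}$$ $$1-D_{\rm inhom}^{CD}(r;a)=\frac1{\nu(C)}\int_C\mathbb E^{!(a,b)}\Big[\prod_{x\in Y}\big(1-u_r^{a,D}(x)\big)\Big]d\nu(b),\qquad 1-F_{\rm inhom}^{D}(r;a)=\mathbb E\Big[\prod_{x\in Y}\big(1-u_r^{a,D}(x)\big)\Big].$$ **Theorem.** (i) For all $n\ge1$ and $r\ge0$, for $\ell$-almost every $a$ the integral $J_n^{CD}(r;a)$ converges absolutely, and as a function of $a$ it is $\ell$-almost everywhere equal to a constant. (ii) For $\ell$-almost every $a\in\mathbb R^d$ the following holds for all $r\ge0$. If $$\limsup_{n\to\infty}\left(\frac{\bar\lambda_D^{\,n}}{n!}\int_{(B(0,r)\times D)^n}\frac{\rho^{(n)}((z_1,m_1),\dots,(z_n,m_n))}{\lambda(z_1,m_1)\cdots\lambda(z_n,m_n)}\prod_{i=1}^n dz_i\,d\nu(m_i)\right)^{1/n}<1$$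 and the series defining $J_{\rm inhom}^{CD}(r;a)$ converges absolutely, then for every base point $a'\in\mathbb R^d$ with $F_{\rm inhom}^{D}(r;a')\ne1$, $$J_{\rm inhom}^{CD}(r;a)=\frac{1-D_{\rm inhom}^{CD}(r;a)}{1-F_{\rm inhom}^{D}(r;a')}.$$ -/

import Mathlib

open MeasureTheory ProbabilityTheory Set Filter Topology
open scoped ENNReal NNReal

namespace MarkedPP

/-- Configurations of a marked point process with simple ground process: sets of (location, mark)
pairs with finitely many points over every bounded region and pairwise distinct locations. -/
def Config (d : ℕ) (M : Type*) : Type _ :=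
  {φ : Set (EuclideanSpace ℝ (Fin d) × M) //
    (∀ R : ℝ, (φ ∩ Metric.closedBall 0 R ×ˢ univ).Finite) ∧ InjOn Prod.fst φ}

/-- The σ-algebra on configurations generated by the counts `φ ↦ #(φ ∩ A)`, `A` measurable. -/
noncomputable instance instMeasurableSpaceConfig (d : ℕ) (M : Type*) [MeasurableSpace M] :
    MeasurableSpace (Config d M) :=
  ⨆ (A : Set (EuclideanSpace ℝ (Fin d) × M)) (_ : MeasurableSet A),
    MeasurableSpace.comap (fun φ : Config d M => (φ.1 ∩ A).encard) ⊤

/-- The configuration with the point `x` removed. -/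
def Config.erase {d : ℕ} {M : Type*} (φ : Config d M) (x : EuclideanSpace ℝ (Fin d) × M) :
    Config d M :=
  ⟨φ.1 \ {x}, fun R => (φ.2.1 R).subset (inter_subset_inter_left _ sdiff_subset),
    φ.2.2.mono sdiff_subset⟩

/-- The sum of `f` over `n`-tuples of pairwise distinct points of `φ`. -/
noncomputable def Config.sumDistinct {d : ℕ} {M : Type*} (φ : Config d M) (n : ℕ)
    (f : (Fin n → EuclideanSpace ℝ (Fin d) × M) → ℝ≥0∞) : ℝ≥0∞ :=
  ∑' x : {x : Fin n → EuclideanSpace ℝ (Fin d) × M // (∀ i, x i ∈ φ.1) ∧ Function.Injective x},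
    f x.1

/-- The intensity function, i.e. the first order product density. -/
def intensity {X : Type*} (ρ : ∀ n : ℕ, (Fin n → X) → ℝ≥0) (x : X) : ℝ≥0 :=
  ρ 1 (fun _ => x)

/-- The correlation functions `ξ_n` of a family of product densities: `ξ_1 = 1` and, for `n ≥ 2`,
`ξ_n` is what remains of `ρ^(n) / ∏ λ` after subtracting the contributions of all partitions of the
index set into at least two blocks. The points of a block are listed by increasing index.
Such blocks have fewer than `n` elements, so the `else` branch in the product is never used. -/
noncomputable def correlation {X : Type*} (ρ : ∀ n : ℕ, (Fin n → X) → ℝ≥0)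
    (n : ℕ) (x : Fin n → X) : ℝ :=
  if n ≤ 1 then 1 else
    (ρ n x : ℝ) / ∏ i, (intensity ρ (x i) : ℝ) -
      ∑ p : Finpartition (Finset.univ : Finset (Fin n)) with 2 ≤ p.parts.card,
        ∏ E ∈ p.parts,
          if _h : E.card < n then correlation ρ E.card (fun j => x (E.orderEmbOfFin rfl j)) else 0
termination_by n

theorem card_block_lt {n : ℕ} (p : Finpartition (Finset.univ : Finset (Fin n)))
    (hp : 2 ≤ p.parts.card) {E : Finset (Fin n)} (hE : E ∈ p.parts) : E.card < n := by
  obtain ⟨F, hF, hne⟩ := Finset.exists_mem_ne (s := p.parts) (by omega) E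
  obtain ⟨i, hi⟩ := p.nonempty_of_mem_parts hF
  have hd : Disjoint F E := p.disjoint hF hE hne
  have hiE : i ∉ E := Finset.disjoint_left.mp hd hi
  have := Finset.card_lt_univ_of_notMem hiE
  simpa using this

/-- The defining relation between correlation functions and product densities: the sum, over all
partitions of the index set, of the products of the correlation functions of the blocks. -/
theorem sum_prod_correlation {X : Type*} (ρ : ∀ n : ℕ, (Fin n → X) → ℝ≥0)
    (n : ℕ) (hn : 2 ≤ n) (x : Fin n → X) :
    ∑ p : Finpartition (Finset.univ : Finset (Fin n)),
      ∏ E ∈ p.parts, correlation ρ E.card (fun j => x (E.orderEmbOfFin rfl j)) =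
    (ρ n x : ℝ) / ∏ i, (intensity ρ (x i) : ℝ) := by
  have : Nonempty (Fin n) := ⟨⟨0, by omega⟩⟩
  have hu : (Finset.univ : Finset (Fin n)) ≠ ⊥ := Finset.univ_nonempty.ne_empty
  have hfil : (Finset.univ.filter
      fun p : Finpartition (Finset.univ : Finset (Fin n)) => ¬ 2 ≤ p.parts.card) =
      {Finpartition.indiscrete hu} := by
    ext p
    simp only [Finset.mem_filter, Finset.mem_univ, true_and, Finset.mem_singleton]
    constructor
    · intro h
      have hne : p.parts.Nonempty := p.parts_nonempty hu
      obtain ⟨E, hE⟩ := Finset.card_eq_one.mp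
        (le_antisymm (by omega) (Finset.card_pos.mpr hne))
      have hs := p.sup_parts
      rw [hE, Finset.sup_singleton] at hs
      apply Finpartition.ext
      simpa [hE] using hs
    · rintro rfl
      simp
  have hcast : ∀ (E : Finset (Fin n)) (k : ℕ) (h : E.card = k),
      correlation ρ E.card (fun j => x (E.orderEmbOfFin rfl j)) =
        correlation ρ k (fun j => x (E.orderEmbOfFin h j)) := by
    rintro E k rfl
    rfl
  have hid : ∀ h : (Finset.univ : Finset (Fin n)).card = n,
      (fun j => x ((Finset.univ : Finset (Fin n)).orderEmbOfFin h j)) = x := by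
    intro h
    have := Finset.orderEmbOfFin_unique h (f := id) (fun _ => Finset.mem_univ _) strictMono_id
    funext j
    rw [← this]
    rfl
  rw [← Finset.sum_filter_add_sum_filter_not Finset.univ
    (fun p : Finpartition (Finset.univ : Finset (Fin n)) => 2 ≤ p.parts.card), hfil,
    Finset.sum_singleton, Finpartition.indiscrete_parts, Finset.prod_singleton,
    hcast Finset.univ n (by simp), hid]
  rw [correlation.eq_1 ρ n x, if_neg (by omega)]
  have : ∀ p ∈ Finset.univ.filter
      (fun p : Finpartition (Finset.univ : Finset (Fin n)) => 2 ≤ p.parts.card),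
      (∏ E ∈ p.parts, if _h : E.card < n then
        correlation ρ E.card (fun j => x (E.orderEmbOfFin rfl j)) else 0) =
      ∏ E ∈ p.parts, correlation ρ E.card (fun j => x (E.orderEmbOfFin rfl j)) := by
    intro p hp
    refine Finset.prod_congr rfl fun E hE => ?_
    rw [dif_pos (card_block_lt p (Finset.mem_filter.mp hp).2 hE)]
  rw [Finset.sum_congr rfl this]
  ring

/-- Translation of the location of a marked point. -/
def shift {d : ℕ} {M : Type*} (a : EuclideanSpace ℝ (Fin d)) (x : EuclideanSpace ℝ (Fin d) × M) :
    EuclideanSpace ℝ (Fin d) × M :=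
  (x.1 + a, x.2)

/-- `ρ n`, `n ≥ 1`, are the product densities of `Y` with respect to `ℓ ⊗ ν`
(`n`-th order Campbell formula). -/
structure IsProductDensity {d : ℕ} {M Ω : Type*} [MeasurableSpace M] [MeasurableSpace Ω]
    (P : Measure Ω) (Y : Ω → Config d M) (ν : Measure M) [IsFiniteMeasure ν]
    (ρ : ∀ n : ℕ, (Fin n → EuclideanSpace ℝ (Fin d) × M) → ℝ≥0) : Prop where
  measurable : ∀ n, Measurable (ρ n)
  campbell : ∀ n, 1 ≤ n → ∀ f : (Fin n → EuclideanSpace ℝ (Fin d) × M) → ℝ≥0∞, Measurable f →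
    ∫⁻ ω, (Y ω).sumDistinct n f ∂P =
      ∫⁻ x, f x * ρ n x ∂(Measure.pi fun _ : Fin n => (volume : Measure _).prod ν)

/-- The infimum `λ̄_D` of the intensity function over all locations and all marks in `D`. -/
noncomputable def lamBar {d : ℕ} {M : Type*}
    (ρ : ∀ n : ℕ, (Fin n → EuclideanSpace ℝ (Fin d) × M) → ℝ≥0) (D : Set M) : ℝ≥0 :=
  sInf (intensity ρ '' (univ ×ˢ D))

/-- Intensity-reweighted moment stationarity of the marked point process `Y` with product
densities `ρ`. -/
structure IsIRMS {d : ℕ} {M Ω : Type*} [MeasurableSpace M] [MeasurableSpace Ω]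
    (P : Measure Ω) (Y : Ω → Config d M) (ν : Measure M) [IsFiniteMeasure ν]
    (ρ : ∀ n : ℕ, (Fin n → EuclideanSpace ℝ (Fin d) × M) → ℝ≥0) : Prop where
  measurable : Measurable Y
  /-- the moment measures of all orders exist, i.e. are locally finite -/
  moments : ∀ (n : ℕ) (R : ℝ),
    ∫⁻ ω, (((Y ω).1 ∩ Metric.closedBall 0 R ×ˢ univ).encard : ℝ≥0∞) ^ n ∂P ≠ ∞
  density : IsProductDensity P Y ν ρ
  translation_invariant : ∀ n, 2 ≤ n → ∀ a : EuclideanSpace ℝ (Fin d),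
    ∀ᵐ x ∂(Measure.pi fun _ : Fin n => (volume : Measure (EuclideanSpace ℝ (Fin d))).prod ν),
      correlation ρ n (fun i => shift a (x i)) = correlation ρ n x
  lamBar_pos : 0 < lamBar ρ univ

/-- `κ (z, m)` are the reduced Palm measures `P^{!(z,m)}` of `Y`
(reduced Campbell-Mecke formula). -/
def IsReducedPalm {d : ℕ} {M Ω : Type*} [MeasurableSpace M] [MeasurableSpace Ω]
    (P : Measure Ω) (Y : Ω → Config d M) (ν : Measure M) [IsFiniteMeasure ν]
    (ρ : ∀ n : ℕ, (Fin n → EuclideanSpace ℝ (Fin d) × M) → ℝ≥0)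
    (κ : Kernel (EuclideanSpace ℝ (Fin d) × M) (Config d M)) : Prop :=
  ∀ f : (EuclideanSpace ℝ (Fin d) × M) × Config d M → ℝ≥0∞, Measurable f →
    ∫⁻ ω, ∑' x : (Y ω).1, f (x.1, (Y ω).erase x.1) ∂P =
      ∫⁻ x, (∫⁻ φ, f (x, φ) ∂κ x) * intensity ρ x ∂((volume : Measure _).prod ν)

/-- The generating functional `v ↦ E ∏_{x} v x` of a probability measure on configurations, the
product running over the points of the configuration. -/
noncomputable def genFun {d : ℕ} {M : Type*} [MeasurableSpace M] (Q : Measure (Config d M))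
    (v : EuclideanSpace ℝ (Fin d) × M → ℝ) : ℝ :=
  ∫ φ, ∏ᶠ x ∈ φ.1, v x ∂Q

/-- The `ν`-averaged generating functional `G^{!a}_C` of the reduced Palm measures. -/
noncomputable def palmGenFun {d : ℕ} {M : Type*} [MeasurableSpace M] (ν : Measure M)
    (κ : Kernel (EuclideanSpace ℝ (Fin d) × M) (Config d M)) (C : Set M)
    (a : EuclideanSpace ℝ (Fin d)) (v : EuclideanSpace ℝ (Fin d) × M → ℝ) : ℝ :=
  (1 / ν.real C) * ∫ b in C, genFun (κ (a, b)) v ∂ν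

open Classical in
/-- The function `u_r^{a,D}`. -/
noncomputable def uFun {d : ℕ} {M : Type*}
    (ρ : ∀ n : ℕ, (Fin n → EuclideanSpace ℝ (Fin d) × M) → ℝ≥0) (D : Set M)
    (a : EuclideanSpace ℝ (Fin d)) (r : ℝ) (x : EuclideanSpace ℝ (Fin d) × M) : ℝ :=
  if x ∈ Metric.closedBall a r ×ˢ D then (lamBar ρ D : ℝ) / intensity ρ x else 0

/-- The inhomogeneous cross nearest neighbour distance distribution function, with base point
`a`. -/
noncomputable def Dinhom {d : ℕ} {M : Type*} [MeasurableSpace M] (ν : Measure M)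
    (ρ : ∀ n : ℕ, (Fin n → EuclideanSpace ℝ (Fin d) × M) → ℝ≥0)
    (κ : Kernel (EuclideanSpace ℝ (Fin d) × M) (Config d M)) (C D : Set M)
    (a : EuclideanSpace ℝ (Fin d)) (r : ℝ) : ℝ :=
  1 - palmGenFun ν κ C a (fun x => 1 - uFun ρ D a r x)

/-- The inhomogeneous empty space function, with base point `a`. -/
noncomputable def Finhom {d : ℕ} {M Ω : Type*} [MeasurableSpace M] [MeasurableSpace Ω]
    (P : Measure Ω) (Y : Ω → Config d M)
    (ρ : ∀ n : ℕ, (Fin n → EuclideanSpace ℝ (Fin d) × M) → ℝ≥0) (D : Set M)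
    (a : EuclideanSpace ℝ (Fin d)) (r : ℝ) : ℝ :=
  1 - genFun (P.map Y) (fun x => 1 - uFun ρ D a r x)

/-- The measure `(ℓ ⊗ ν)^n` restricted to `(B(0,r) × D)^n`. -/
noncomputable def ballMeasure {d : ℕ} {M : Type*} [MeasurableSpace M] (ν : Measure M)
    (D : Set M) (r : ℝ) (n : ℕ) : Measure (Fin n → EuclideanSpace ℝ (Fin d) × M) :=
  Measure.pi fun _ : Fin n =>
    ((volume : Measure (EuclideanSpace ℝ (Fin d))).prod ν).restrict
      (Metric.closedBall 0 r ×ˢ D)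

/-- The integrand `ξ_{n+1}((a,b), (z_1 + a, m_1), …, (z_n + a, m_n))` of `J_n`, as a function of
`b` and `(z_i, m_i)`. -/
noncomputable def Jintegrand {d : ℕ} {M : Type*}
    (ρ : ∀ n : ℕ, (Fin n → EuclideanSpace ℝ (Fin d) × M) → ℝ≥0) (n : ℕ)
    (a : EuclideanSpace ℝ (Fin d)) (y : M × (Fin n → EuclideanSpace ℝ (Fin d) × M)) : ℝ :=
  correlation ρ (n + 1) (Fin.cons (a, y.1) fun i => shift a (y.2 i))

/-- `J_n^{CD}(r)` with base point `a`. -/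
noncomputable def Jn {d : ℕ} {M : Type*} [MeasurableSpace M] (ν : Measure M)
    (ρ : ∀ n : ℕ, (Fin n → EuclideanSpace ℝ (Fin d) × M) → ℝ≥0) (C D : Set M) (n : ℕ)
    (a : EuclideanSpace ℝ (Fin d)) (r : ℝ) : ℝ :=
  ∫ y, Jintegrand ρ n a y ∂((ν.restrict C).prod (ballMeasure ν D r n))

/-- The `n`-th term, `n ≥ 1`, of the series defining the inhomogeneous cross `J`-function. -/
noncomputable def Jterm {d : ℕ} {M : Type*} [MeasurableSpace M] (ν : Measure M)
    (ρ : ∀ n : ℕ, (Fin n → EuclideanSpace ℝ (Fin d) × M) → ℝ≥0) (C D : Set M)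
    (a : EuclideanSpace ℝ (Fin d)) (r : ℝ) (n : ℕ) : ℝ :=
  (-(lamBar ρ D : ℝ)) ^ n / n.factorial * Jn ν ρ C D n a r

/-- The inhomogeneous cross `J`-function, with base point `a`. -/
noncomputable def Jinhom {d : ℕ} {M : Type*} [MeasurableSpace M] (ν : Measure M)
    (ρ : ∀ n : ℕ, (Fin n → EuclideanSpace ℝ (Fin d) × M) → ℝ≥0) (C D : Set M)
    (a : EuclideanSpace ℝ (Fin d)) (r : ℝ) : ℝ :=
  1 / ν.real C * (ν.real C + ∑' n : ℕ, Jterm ν ρ C D a r (n + 1))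

/-- The domain of the `J`-function: the series is absolutely convergent at range `r`. -/
def JConverges {d : ℕ} {M : Type*} [MeasurableSpace M] (ν : Measure M)
    (ρ : ∀ n : ℕ, (Fin n → EuclideanSpace ℝ (Fin d) × M) → ℝ≥0) (C D : Set M)
    (a : EuclideanSpace ℝ (Fin d)) (r : ℝ) : Prop :=
  Summable fun n : ℕ => |Jterm ν ρ C D a r (n + 1)|

/-- The `n`-th root of `λ̄_D^n / n!` times the integral over `(B(0,r) × D)^n` of the reweighted
product density `ρ^(n) / ∏ λ`. -/
noncomputable def rootTerm {d : ℕ} {M : Type*} [MeasurableSpace M] (ν : Measure M)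
    (ρ : ∀ n : ℕ, (Fin n → EuclideanSpace ℝ (Fin d) × M) → ℝ≥0) (D : Set M) (r : ℝ)
    (n : ℕ) : ℝ≥0∞ :=
  ((lamBar ρ D : ℝ≥0∞) ^ n / (n.factorial : ℝ≥0∞) *
    ∫⁻ x, ((ρ n x / ∏ i, intensity ρ (x i) : ℝ≥0) : ℝ≥0∞) ∂(ballMeasure ν D r n)) ^ (1 / (n : ℝ))

end MarkedPP

open MarkedPP

/-!
Write `X = ℝ^d × M`, `μ = ℓ ⊗ ν`, and let `reweighted ρ n` be `ρ^(n) / ∏ λ` (equal to `1` for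
`n = 0`). Two expansions of generating functionals are compared.

*Cluster expansion.* Sorting the set partitions in the definition of the correlation functions by
the block that contains a distinguished point gives (`reweighted_cons`)
`ρ^(n+1)(x₀, x) / (λ(x₀) ∏ λ(x_i)) = ∑_T ξ_{|T|+1}(x₀, x_T) · ρ^(|Tᶜ|)(x_{Tᶜ}) / ∏_{i ∉ T} λ(x_i)`,
the sum running over all `T ⊆ {1, …, n}`. The moment assumption and `inf λ > 0` make the left-hand
side locally integrable. As the variables in `T` and in `Tᶜ` are disjoint, the products on the right
integrate by Fubini, and solving for `T = {1, …, n}` shows inductively that the `ξ_n` are locally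
integrable (`integrable_correlation`). A measure preserving change of variables then gives the
integrability of the integrand of `J_n` for almost every base point, and translation invariance of
`ξ_{n+1}` makes `J_n` invariant under each translation up to null sets, hence almost everywhere
constant (`exists_ae_eq_const_of_translation_invariant`).

*Generating functionals.* For `0 ≤ u` with bounded support, `∏_{x ∈ φ} (1 - u x)` is pathwise the
finite alternating sum of the elementary symmetric functions of the values of `u`. It may be
integrated term by term whenever the factorial moments are summable (`hasSum_genFun`). For the
law of `Y` and `u = u_r^{a',D}` the `n`-th moment is `λ̄^n / n! · R_n`, where `R_n` is the integral
of the reweighted density; it does not depend on `a'`, because the reweighted densities inherit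
translation invariance from the `ξ_n`. The root test makes this series converge.

For the Palm side, almost every `P^{!x}` has product densities `ρ^(n+1)(x, ·) / λ(x)`
(`ae_forall_palm_sumDistinct`). Hence the `n`-th moment of the mixture of the `P^{!(a,b)}` over
`b ∈ C` is `λ̄^n / n!` times the integral of the left-hand side of the cluster expansion, that is,
`λ̄^n / n! · ∑_k (n choose k) J_k R_{n-k}` with `J_0 = ν(C)`. This is the Cauchy product of the two
absolutely convergent series for `J` and for `1 - F`, so the Palm series converges absolutely too and
`ν(C) (1 - D) = ν(C) J · (1 - F)`.
-/

namespace MarkedPP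

/-! ### Sums over set partitions -/

/-- The sum over all partitions of `s` of the product of the weights `Ξ E` of the blocks `E`. -/
noncomputable def partitionSum {ι : Type*} [DecidableEq ι] (Ξ : Finset ι → ℝ) (s : Finset ι) : ℝ :=
  ∑ p : Finpartition s, ∏ E ∈ p.parts, Ξ E

theorem partitionSum_empty {ι : Type*} [DecidableEq ι] (Ξ : Finset ι → ℝ) :
    partitionSum Ξ ∅ = 1 := by
  have : ∀ p : Finpartition (∅ : Finset ι), ∏ E ∈ p.parts, Ξ E = 1 := by
    intro p
    have : p.parts = ∅ := p.parts_eq_empty_iff.mpr rfl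
    simp [this]
  unfold partitionSum
  rw [Finset.sum_congr rfl fun p _ => this p]
  have : Fintype.card (Finpartition (∅ : Finset ι)) = 1 :=
    @Fintype.card_unique (Finpartition (⊥ : Finset ι)) _ _
  simp [this]

/-- Every partition of `s` consists of the block `insert i T` of a distinguished element `i` and of
a partition of the remaining elements. -/
theorem partitionSum_eq_sum_powerset {ι : Type*} [DecidableEq ι] (Ξ : Finset ι → ℝ)
    {s : Finset ι} {i : ι} (hi : i ∈ s) :
    partitionSum Ξ s =
      ∑ T ∈ (s.erase i).powerset, Ξ (insert i T) * partitionSum Ξ (s.erase i \ T) := by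
  unfold partitionSum
  simp_rw [Finset.mul_sum]
  rw [Finset.sum_sigma']
  symm
  have hdisj : ∀ T ∈ (s.erase i).powerset, Disjoint (s.erase i \ T) (insert i T) := by
    intro T _
    rw [Finset.disjoint_left]
    simp +contextual
  have hsup : ∀ T ∈ (s.erase i).powerset, (s.erase i \ T) ⊔ insert i T = s := by
    intro T hT
    rw [Finset.mem_powerset] at hT
    ext j
    have := @hT j
    by_cases hj : j = i
    · subst hj; simp [hi]
    · simp only [Finset.sup_eq_union, Finset.mem_union, Finset.mem_sdiff, Finset.mem_erase,
        Finset.mem_insert] at this ⊢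
      tauto
  have hnot : ∀ T, ∀ q : Finpartition (s.erase i \ T), ∀ E ∈ q.parts, i ∉ E := by
    intro T q E hE h
    have := q.le hE h
    simp at this
  refine Finset.sum_bij (fun a ha => a.2.extend (b := insert i a.1) (c := s)
      (Finset.insert_nonempty _ _).ne_empty
      (hdisj _ (Finset.mem_sigma.mp ha).1) (hsup _ (Finset.mem_sigma.mp ha).1))
    (fun _ _ => Finset.mem_univ _) ?_ ?_ ?_
  · rintro ⟨T, q⟩ ha ⟨T', q'⟩ ha' h
    have hp := congrArg Finpartition.parts h
    simp only [Finpartition.extend_parts] at hp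
    have hT : i ∉ T := fun h => by
      simpa using Finset.mem_powerset.mp (Finset.mem_sigma.mp ha).1 h
    have hT' : i ∉ T' := fun h => by
      simpa using Finset.mem_powerset.mp (Finset.mem_sigma.mp ha').1 h
    have hb : insert i T = insert i T' := by
      have : insert i T ∈ insert (insert i T') q'.parts := hp ▸ Finset.mem_insert_self _ _
      rcases Finset.mem_insert.mp this with h | h
      · exact h
      · exact absurd (Finset.mem_insert_self _ _) (hnot _ _ _ h)
    have hTT : T = T' := by
      rw [← Finset.erase_insert hT, hb, Finset.erase_insert hT']
    subst hTT
    have h1 : ∀ q : Finpartition (s.erase i \ T), insert i T ∉ q.parts := fun q h =>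
      hnot _ _ _ h (Finset.mem_insert_self _ _)
    have : q = q' := by
      apply Finpartition.ext
      rw [← Finset.erase_insert (h1 q), hp, Finset.erase_insert (h1 q')]
    rw [this]
  · intro p _
    have hmem : i ∈ p.part i := p.mem_part hi
    have hpart : p.part i ∈ p.parts := p.part_mem.mpr hi
    have hsub : p.part i ⊆ s := p.le hpart
    have hT : (p.part i).erase i ∈ (s.erase i).powerset :=
      Finset.mem_powerset.mpr (Finset.erase_subset_erase _ hsub)
    have hs : (p.parts.erase (p.part i)).sup id = s.erase i \ (p.part i).erase i := by
      ext j
      simp only [Finset.mem_sup, Finset.mem_erase, id, Finset.mem_sdiff]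
      constructor
      · rintro ⟨E, ⟨hne, hE⟩, hj⟩
        have hd := Finset.disjoint_left.mp (p.disjoint hE hpart hne) hj
        refine ⟨⟨?_, p.le hE hj⟩, fun h => hd h.2⟩
        rintro rfl
        exact hd hmem
      · rintro ⟨⟨hji, hj⟩, hn⟩
        refine ⟨p.part j, ⟨fun h => hn ⟨hji, h ▸ p.mem_part hj⟩, p.part_mem.mpr hj⟩,
          p.mem_part hj⟩
    refine ⟨⟨(p.part i).erase i, p.ofSubset (Finset.erase_subset _ _) hs⟩,
      Finset.mem_sigma.mpr ⟨hT, Finset.mem_univ _⟩, ?_⟩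
    apply Finpartition.ext
    simp only [Finpartition.extend_parts, Finpartition.ofSubset_parts, Finset.insert_erase hmem,
      Finset.insert_erase hpart]
  · rintro ⟨T, q⟩ ha
    rw [Finpartition.extend_parts, Finset.prod_insert]
    exact fun h => hnot _ _ _ h (Finset.mem_insert_self _ _)

/-- The weights of partitions may be transported along an embedding of index sets. -/
theorem partitionSum_map {ι κ : Type*} [DecidableEq ι] [DecidableEq κ] (e : ι ↪ κ)
    (Ξ : Finset κ → ℝ) (s : Finset ι) :
    partitionSum Ξ (s.map e) = partitionSum (fun E => Ξ (E.map e)) s := by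
  induction s using Finset.strongInduction with
  | H s ih =>
    rcases s.eq_empty_or_nonempty with rfl | ⟨i, hi⟩
    · simp [partitionSum_empty]
    · rw [partitionSum_eq_sum_powerset Ξ (Finset.mem_map_of_mem e hi),
        partitionSum_eq_sum_powerset _ hi, ← Finset.map_erase]
      symm
      refine Finset.sum_bij (fun T _ => T.map e) ?_ ?_ ?_ ?_
      · intro T hT
        exact Finset.mem_powerset.mpr (Finset.map_subset_map.mpr (Finset.mem_powerset.mp hT))
      · intro T _ T' _ h
        exact Finset.map_injective e h
      · intro T hT
        obtain ⟨u, hu, rfl⟩ := Finset.subset_map_iff.mp (Finset.mem_powerset.mp hT)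
        exact ⟨u, Finset.mem_powerset.mpr hu, rfl⟩
      · intro T hT
        rw [Finset.map_insert, ← Finset.map_sdiff, ih]
        exact (Finset.sdiff_subset).trans_ssubset (Finset.erase_ssubset hi)

/-! ### The cluster expansion of the reweighted product densities -/

section Cluster

variable {X : Type*} (ρ : ∀ n : ℕ, (Fin n → X) → ℝ≥0)

/-- The reweighted product density `ρ^(n) / ∏ λ`; for `n = 0`, where the value of `ρ 0` carries no
information, it is `1`. -/
noncomputable def reweighted (n : ℕ) (x : Fin n → X) : ℝ≥0 :=
  if n = 0 then 1 else ρ n x / ∏ i, intensity ρ (x i)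

theorem reweighted_zero (x : Fin 0 → X) : reweighted ρ 0 x = 1 := by simp [reweighted]

theorem reweighted_of_ne_zero {n : ℕ} (hn : n ≠ 0) (x : Fin n → X) :
    reweighted ρ n x = ρ n x / ∏ i, intensity ρ (x i) := by simp [reweighted, hn]

theorem reweighted_one (hpos : ∀ x, 0 < intensity ρ x) (x : Fin 1 → X) :
    reweighted ρ 1 x = 1 := by
  rw [reweighted_of_ne_zero ρ one_ne_zero]
  have : ρ 1 x = intensity ρ (x 0) := by
    unfold intensity
    congr 1
    funext i
    rw [Subsingleton.elim i 0]
  simp [this, (hpos _).ne']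

theorem correlation_of_le_one {n : ℕ} (hn : n ≤ 1) (x : Fin n → X) : correlation ρ n x = 1 := by
  rw [correlation, if_pos hn]

/-- The correlation function of the points of the block `E` of `x`. -/
noncomputable def blockCorrelation {ι : Type*} [LinearOrder ι] (x : ι → X) (E : Finset ι) : ℝ :=
  correlation ρ E.card fun j => x (E.orderEmbOfFin rfl j)

/-- The correlation function of a block is read off from any increasing enumeration of it; the
correlation functions are not assumed to be symmetric. -/
theorem blockCorrelation_eq {ι : Type*} [LinearOrder ι] (x : ι → X) {E : Finset ι} {k : ℕ}
    (hE : E.card = k) {f : Fin k → ι} (hf : StrictMono f) (hfE : ∀ j, f j ∈ E) :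
    blockCorrelation ρ x E = correlation ρ k (x ∘ f) := by
  subst hE
  rw [Finset.orderEmbOfFin_unique rfl hfE hf]
  rfl

theorem blockCorrelation_map {ι κ : Type*} [LinearOrder ι] [LinearOrder κ] (e : ι ↪o κ)
    (x : κ → X) (E : Finset ι) :
    blockCorrelation ρ x (E.map e.toEmbedding) = blockCorrelation ρ (x ∘ e) E := by
  rw [blockCorrelation_eq ρ x (k := E.card) (by simp) (f := fun j => e (E.orderEmbOfFin rfl j))]
  · rfl
  · exact fun i j h => e.strictMono ((E.orderEmbOfFin rfl).strictMono h)
  · intro j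
    exact Finset.mem_map_of_mem _ (Finset.orderEmbOfFin_mem _ _ _)

theorem reweighted_eq_partitionSum (hpos : ∀ x, 0 < intensity ρ x) (n : ℕ) (x : Fin n → X) :
    (reweighted ρ n x : ℝ) = partitionSum (blockCorrelation ρ x) Finset.univ := by
  rcases Nat.lt_or_ge n 2 with hn | hn
  · interval_cases n
    · rw [reweighted_zero, Finset.univ_eq_empty, partitionSum_empty]
      simp
    · rw [reweighted_one ρ hpos, partitionSum_eq_sum_powerset _ (Finset.mem_univ (0 : Fin 1))]
      simp [partitionSum_empty, blockCorrelation, correlation_of_le_one]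
  · rw [reweighted_of_ne_zero ρ (by omega)]
    push_cast
    rw [← sum_prod_correlation ρ n hn x]
    rfl

/-- Sorting the partitions of `{0, …, n}` by the block of `0` expresses the reweighted product
densities through correlation functions of clusters containing a given point. -/
theorem reweighted_cons (hpos : ∀ x, 0 < intensity ρ x) (n : ℕ) (x₀ : X) (x : Fin n → X) :
    (reweighted ρ (n + 1) (Fin.cons x₀ x : Fin (n + 1) → X) : ℝ) =
      ∑ T : Finset (Fin n),
        correlation ρ (T.card + 1) (Fin.cons x₀ fun j => x (T.orderEmbOfFin rfl j)) *
          reweighted ρ Tᶜ.card fun j => x (Tᶜ.orderEmbOfFin rfl j) := by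
  have herase : (Finset.univ : Finset (Fin (n + 1))).erase 0 =
      Finset.univ.map (Fin.succEmb n) := by
    ext i
    cases i using Fin.cases <;> simp
  rw [reweighted_eq_partitionSum ρ hpos, partitionSum_eq_sum_powerset _ (Finset.mem_univ 0), herase]
  symm
  refine Finset.sum_bij (fun T _ => T.map (Fin.succEmb n)) ?_ ?_ ?_ ?_
  · intro T _
    exact Finset.mem_powerset.mpr (Finset.map_subset_map.mpr (Finset.subset_univ _))
  · intro T _ T' _ h
    exact Finset.map_injective _ h
  · intro T hT
    obtain ⟨u, hu, rfl⟩ := Finset.subset_map_iff.mp (Finset.mem_powerset.mp hT)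
    exact ⟨u, Finset.mem_univ _, rfl⟩
  · intro T _
    congr 1
    · have h0 : (0 : Fin (n + 1)) ∉ T.map (Fin.succEmb n) := by simp
      rw [blockCorrelation_eq ρ _ (k := T.card + 1) (by simp [h0])
        (f := Fin.cons 0 fun j => (T.orderEmbOfFin rfl j).succ)]
      · congr 1
        funext j
        cases j using Fin.cases <;> simp
      · intro a b hab
        cases b using Fin.cases with
        | zero => exact absurd hab (Fin.not_lt_zero _)
        | succ b =>
          cases a using Fin.cases with
          | zero => simp
          | succ a => simpa using hab
      · intro j
        cases j using Fin.cases <;> simp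
    · have hc : (Finset.univ.map (Fin.succEmb n)) \ T.map (Fin.succEmb n) =
          Finset.univ.map ((Tᶜ.orderEmbOfFin rfl).trans (Fin.succOrderEmb n)).toEmbedding := by
        rw [← Finset.map_sdiff, ← Finset.compl_eq_univ_sdiff]
        have : Finset.univ.map (Tᶜ.orderEmbOfFin rfl).toEmbedding = Tᶜ := by
          simp
        conv_lhs => rw [← this, Finset.map_map]
        rfl
      rw [hc, partitionSum_map, reweighted_eq_partitionSum ρ hpos]
      congr 1
      funext E
      rw [blockCorrelation_map]
      rfl

end Cluster

/-! ### Splitting and shifting product measures -/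

section Split

variable {X : Type*} [MeasurableSpace X]

/-- Separating the coordinates in `T` from the others is measure preserving. -/
theorem measurePreserving_restrict_coords (m : Measure X) [SigmaFinite m] {n : ℕ}
    (T : Finset (Fin n)) :
    MeasurePreserving (fun z : Fin n → X =>
        ((fun j => z (T.orderEmbOfFin rfl j) : Fin T.card → X),
          (fun j => z (Tᶜ.orderEmbOfFin rfl j) : Fin Tᶜ.card → X)))
      (Measure.pi fun _ => m) ((Measure.pi fun _ => m).prod (Measure.pi fun _ => m)) := by
  have h1 := (measurePreserving_piCongrLeft (α := fun _ => X) (fun _ : Fin n => m)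
    (finSumEquivOfFinset (s := T) rfl rfl)).symm
  have h2 := measurePreserving_sumPiEquivProdPi
    (fun _ : Fin T.card ⊕ Fin Tᶜ.card => m)
  exact h2.comp h1

theorem measurePreserving_cons (m : Measure X) [SigmaFinite m] (n : ℕ) :
    MeasurePreserving (fun p : X × (Fin n → X) => (Fin.cons p.1 p.2 : Fin (n + 1) → X))
      (m.prod (Measure.pi fun _ => m)) (Measure.pi fun _ => m) := by
  convert! (measurePreserving_piFinSuccAbove (fun _ : Fin (n + 1) => m) 0).symm using 1
  funext p i
  simp [MeasurableEquiv.piFinSuccAbove]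

theorem measurable_cons (n : ℕ) :
    Measurable fun p : X × (Fin n → X) => (Fin.cons p.1 p.2 : Fin (n + 1) → X) := by
  rw [measurable_pi_iff]
  intro i
  cases i using Fin.cases
  · simpa using measurable_fst
  · simp only [Fin.cons_succ]
    fun_prop

variable {Z : Type*} [MeasurableSpace Z]

theorem measurePreserving_prod_restrict_coords (α : Measure Z) [SFinite α] (m : Measure X)
    [SigmaFinite m] {n : ℕ} (T : Finset (Fin n)) :
    MeasurePreserving (fun y : Z × (Fin n → X) =>
        ((y.1, (fun j => y.2 (T.orderEmbOfFin rfl j) : Fin T.card → X)),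
          (fun j => y.2 (Tᶜ.orderEmbOfFin rfl j) : Fin Tᶜ.card → X)))
      (α.prod (Measure.pi fun _ => m))
      ((α.prod (Measure.pi fun _ => m)).prod (Measure.pi fun _ => m)) :=
  ((measurePreserving_prodAssoc α (Measure.pi fun _ : Fin T.card => m)
    (Measure.pi fun _ : Fin Tᶜ.card => m)).symm MeasurableEquiv.prodAssoc).comp
    ((MeasurePreserving.id α).prod (measurePreserving_restrict_coords m T))

theorem integrable_mul_coords {α : Measure Z} [SFinite α] {m : Measure X} [SigmaFinite m] {n : ℕ}
    (T : Finset (Fin n)) {f : Z × (Fin T.card → X) → ℝ} {g : (Fin Tᶜ.card → X) → ℝ}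
    (hf : Integrable f (α.prod (Measure.pi fun _ => m)))
    (hg : Integrable g (Measure.pi fun _ => m)) :
    Integrable (fun y : Z × (Fin n → X) => f (y.1, fun j => y.2 (T.orderEmbOfFin rfl j)) *
      g fun j => y.2 (Tᶜ.orderEmbOfFin rfl j)) (α.prod (Measure.pi fun _ => m)) :=
  (measurePreserving_prod_restrict_coords α m T).integrable_comp_of_integrable (hf.mul_prod hg)

theorem integral_mul_coords {α : Measure Z} [SFinite α] {m : Measure X} [SigmaFinite m] {n : ℕ}
    (T : Finset (Fin n)) {f : Z × (Fin T.card → X) → ℝ} {g : (Fin Tᶜ.card → X) → ℝ}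
    (hf : Integrable f (α.prod (Measure.pi fun _ => m)))
    (hg : Integrable g (Measure.pi fun _ => m)) :
    ∫ y : Z × (Fin n → X), f (y.1, fun j => y.2 (T.orderEmbOfFin rfl j)) *
      g (fun j => y.2 (Tᶜ.orderEmbOfFin rfl j)) ∂(α.prod (Measure.pi fun _ => m)) =
    (∫ y, f y ∂(α.prod (Measure.pi fun _ => m))) * ∫ z, g z ∂(Measure.pi fun _ => m) := by
  have h := measurePreserving_prod_restrict_coords α m T
  rw [← integral_prod_mul, ← h.map_eq, integral_map h.measurable.aemeasurable]
  rw [h.map_eq]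
  exact (hf.mul_prod hg).aestronglyMeasurable

variable (ρ : ∀ n : ℕ, (Fin n → X) → ℝ≥0)

theorem measurable_intensity (hm : ∀ n, Measurable (ρ n)) : Measurable (intensity ρ) :=
  (hm 1).comp (measurable_pi_iff.mpr fun _ => measurable_id)

theorem measurable_reweighted (hm : ∀ n, Measurable (ρ n)) (n : ℕ) :
    Measurable (reweighted ρ n) := by
  by_cases hn : n = 0
  · subst hn
    have : reweighted ρ 0 = fun _ => 1 := funext (reweighted_zero ρ)
    rw [this]
    exact measurable_const
  · have : reweighted ρ n = fun x => ρ n x / ∏ i, intensity ρ (x i) :=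
      funext (reweighted_of_ne_zero ρ hn)
    rw [this]
    exact (hm n).div (Finset.measurable_prod _ fun i _ =>
      (measurable_intensity ρ hm).comp (measurable_pi_apply i))

theorem measurable_correlation (hm : ∀ n, Measurable (ρ n)) (n : ℕ) :
    Measurable (correlation ρ n) := by
  induction n using Nat.strong_induction_on with
  | _ n ih =>
    by_cases hn : n ≤ 1
    · have : correlation ρ n = fun _ => 1 := funext (correlation_of_le_one ρ hn)
      rw [this]
      exact measurable_const
    · have : correlation ρ n = _ := funext fun x => correlation.eq_1 ρ n x
      rw [this]
      simp only [hn, if_false]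
      refine Measurable.sub ?_ (Finset.measurable_fun_sum _ fun p _ =>
        Finset.measurable_fun_prod _ fun E _ => ?_)
      · exact (measurable_coe_nnreal_real.comp (hm n)).div (Finset.measurable_fun_prod _ fun i _ =>
          measurable_coe_nnreal_real.comp
            ((measurable_intensity ρ hm).comp (measurable_pi_apply i)))
      · split_ifs with h
        · exact (ih _ h).comp (measurable_pi_iff.mpr fun j => measurable_pi_apply _)
        · exact measurable_const

/-- Local integrability passes from the reweighted densities to the correlation functions, since the
term of the full index set in the cluster expansion is the only one of highest order. -/
theorem integrable_correlation (hpos : ∀ x, 0 < intensity ρ x)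
    {m : Measure X} [IsFiniteMeasure m]
    (hint : ∀ n, Integrable (fun x => (reweighted ρ n x : ℝ)) (Measure.pi fun _ => m)) (n : ℕ) :
    Integrable (fun y : X × (Fin n → X) => correlation ρ (n + 1) (Fin.cons y.1 y.2))
      (m.prod (Measure.pi fun _ => m)) := by
  induction n using Nat.strong_induction_on with
  | _ n ih =>
    -- Solve the cluster expansion for the term of the full index set.
    have key : ∀ y : X × (Fin n → X), correlation ρ (n + 1) (Fin.cons y.1 y.2) =
        (reweighted ρ (n + 1) (Fin.cons y.1 y.2 : Fin (n + 1) → X) : ℝ) -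
        ∑ T ∈ (Finset.univ : Finset (Finset (Fin n))).erase Finset.univ,
          correlation ρ (T.card + 1) (Fin.cons y.1 fun j => y.2 (T.orderEmbOfFin rfl j)) *
            reweighted ρ Tᶜ.card fun j => y.2 (Tᶜ.orderEmbOfFin rfl j) := by
      intro y
      rw [reweighted_cons ρ hpos, ← Finset.add_sum_erase _ _ (Finset.mem_univ Finset.univ)]
      have h1 : reweighted ρ (Finset.univ : Finset (Fin n))ᶜ.card
          (fun j => y.2 ((Finset.univ : Finset (Fin n))ᶜ.orderEmbOfFin rfl j)) = 1 := by
        unfold reweighted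
        simp
      have h2 : correlation ρ ((Finset.univ : Finset (Fin n)).card + 1) (Fin.cons y.1
          fun j => y.2 ((Finset.univ : Finset (Fin n)).orderEmbOfFin rfl j)) =
          correlation ρ (n + 1) (Fin.cons y.1 y.2) := by
        have hcast : ∀ (E : Finset (Fin n)) (k : ℕ) (h : E.card = k),
            correlation ρ (E.card + 1) (Fin.cons y.1 fun j => y.2 (E.orderEmbOfFin rfl j)) =
              correlation ρ (k + 1) (Fin.cons y.1 fun j => y.2 (E.orderEmbOfFin h j)) := by
          rintro E k rfl
          rfl
        rw [hcast _ n (by simp)]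
        have := Finset.orderEmbOfFin_unique (s := (Finset.univ : Finset (Fin n))) (k := n)
          (by simp) (f := id) (fun _ => Finset.mem_univ _) strictMono_id
        rw [← this]
        rfl
      rw [h1, h2]
      simp
    simp_rw [key]
    refine Integrable.sub ?_ (integrable_finsetSum _ fun T hT => ?_)
    · exact (measurePreserving_cons m n).integrable_comp_of_integrable (hint (n + 1))
    · have hlt : T.card < n := by
        have : T ⊂ Finset.univ := Finset.ssubset_univ_iff.mpr (Finset.ne_of_mem_erase hT)
        simpa using Finset.card_lt_card this
      exact integrable_mul_coords T (ih _ hlt) (hint _)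

end Split

/-! ### Sums over distinct points of a configuration -/

/-- If `f` vanishes on tuples of points of `φ` that do not lie in the finite set `s`, then the sum over
distinct points is a finite sum. -/
theorem Config.sumDistinct_eq_sum {d : ℕ} {M : Type*} (φ : Config d M) (n : ℕ)
    (f : (Fin n → EuclideanSpace ℝ (Fin d) × M) → ℝ≥0∞)
    (s : Finset (EuclideanSpace ℝ (Fin d) × M)) (hs : ∀ x ∈ s, x ∈ φ.1)
    (hf : ∀ x, (∀ i, x i ∈ φ.1) → f x ≠ 0 → ∀ i, x i ∈ s) [DecidablePred
      (Function.Injective : (Fin n → EuclideanSpace ℝ (Fin d) × M) → Prop)] :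
    φ.sumDistinct n f = ∑ x ∈ (Fintype.piFinset fun _ : Fin n => s) with Function.Injective x,
      f x := by
  obtain ⟨A, hA⟩ : ∃ A : Set (Fin n → EuclideanSpace ℝ (Fin d) × M),
    A = {x | (∀ i, x i ∈ φ.1) ∧ Function.Injective x} := ⟨_, rfl⟩
  have hmem : ∀ x, x ∈ A ↔ (∀ i, x i ∈ φ.1) ∧ Function.Injective x := fun x => by rw [hA]; rfl
  have hsum : φ.sumDistinct n f = ∑' x : A, f x := by
    rw [hA]
    rfl
  rw [hsum, tsum_subtype A f,
    tsum_eq_sum (s := (Fintype.piFinset fun _ : Fin n => s).filter Function.Injective)]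
  · refine Finset.sum_congr rfl fun x hx => ?_
    rw [Finset.mem_filter, Fintype.mem_piFinset] at hx
    exact indicator_of_mem ((hmem x).mpr ⟨fun i => hs _ (hx.1 i), hx.2⟩) _
  · intro x hx
    by_cases h : x ∈ A
    · rw [indicator_of_mem h]
      by_contra h0
      have h' := (hmem x).mp h
      exact hx (Finset.mem_filter.mpr ⟨Fintype.mem_piFinset.mpr (hf x h'.1 h0), h'.2⟩)
    · exact indicator_of_notMem h _

theorem Config.sumDistinct_indicator_le {d : ℕ} {M : Type*} (φ : Config d M) (n : ℕ) (R : ℝ) :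
    φ.sumDistinct n ((univ.pi fun _ => Metric.closedBall 0 R ×ˢ univ).indicator 1) ≤
      ((φ.1 ∩ Metric.closedBall 0 R ×ˢ univ).encard : ℝ≥0∞) ^ n := by
  classical
  have hfin := φ.2.1 R
  rw [φ.sumDistinct_eq_sum n _ hfin.toFinset]
  · rw [hfin.encard_eq_coe_toFinset_card]
    calc _ ≤ ∑ x ∈ (Fintype.piFinset fun _ : Fin n => hfin.toFinset) with Function.Injective x,
          (1 : ℝ≥0∞) := Finset.sum_le_sum fun x _ => indicator_le_self' (by simp) x
      _ ≤ ∑ x ∈ (Fintype.piFinset fun _ : Fin n => hfin.toFinset), (1 : ℝ≥0∞) :=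
          Finset.sum_le_sum_of_subset (Finset.filter_subset _ _)
      _ = _ := by simp
  · intro x hx
    exact ((Set.Finite.mem_toFinset _).mp hx).1
  · intro x hx h0 i
    have := mem_of_indicator_ne_zero h0
    exact (Set.Finite.mem_toFinset _).mpr ⟨hx i, this i (mem_univ i)⟩

theorem Config.sumDistinct_eq_tsum {d : ℕ} {M : Type*} (φ : Config d M) (n : ℕ)
    (f : (Fin n → EuclideanSpace ℝ (Fin d) × M) → ℝ≥0∞)
    [∀ x : Fin n → EuclideanSpace ℝ (Fin d) × M,
      Decidable ((∀ i, x i ∈ φ.1) ∧ Function.Injective x)] :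
    φ.sumDistinct n f =
      ∑' x, if (∀ i, x i ∈ φ.1) ∧ Function.Injective x then f x else 0 := by
  refine (tsum_subtype {x : Fin n → EuclideanSpace ℝ (Fin d) × M |
    (∀ i, x i ∈ φ.1) ∧ Function.Injective x} f).trans (tsum_congr fun x => ?_)
  rw [indicator_apply]
  rfl

theorem Config.sumDistinct_zero {d : ℕ} {M : Type*} (φ : Config d M)
    (f : (Fin 0 → EuclideanSpace ℝ (Fin d) × M) → ℝ≥0∞) :
    φ.sumDistinct 0 f = f Fin.elim0 := by
  classical
  rw [sumDistinct_eq_tsum, tsum_eq_single Fin.elim0 fun x hx => absurd (Subsingleton.elim _ _) hx,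
    if_pos]
  exact ⟨fun i => i.elim0, Function.injective_of_subsingleton _⟩

/-- Summing over the first point of a tuple of distinct points. -/
theorem Config.sumDistinct_succ {d : ℕ} {M : Type*} (φ : Config d M) (n : ℕ)
    (f : (Fin (n + 1) → EuclideanSpace ℝ (Fin d) × M) → ℝ≥0∞) :
    φ.sumDistinct (n + 1) f =
      ∑' x₀ : φ.1, (φ.erase x₀.1).sumDistinct n fun x => f (Fin.cons x₀.1 x) := by
  classical
  rw [sumDistinct_eq_tsum, ← (Fin.consEquiv fun _ => EuclideanSpace ℝ (Fin d) × M).tsum_eq,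
    ENNReal.tsum_prod']
  refine Eq.trans ?_ (tsum_subtype φ.1 fun x₀ =>
      (φ.erase x₀).sumDistinct n fun x => f (Fin.cons x₀ x)).symm
  refine tsum_congr fun x₀ => ?_
  rw [indicator_apply]
  have key : ∀ x : Fin n → EuclideanSpace ℝ (Fin d) × M,
      ((∀ i, (Fin.cons x₀ x : Fin (n + 1) → EuclideanSpace ℝ (Fin d) × M) i ∈ φ.1) ∧
        Function.Injective (Fin.cons x₀ x : Fin (n + 1) → EuclideanSpace ℝ (Fin d) × M)) ↔
      x₀ ∈ φ.1 ∧ (∀ i, x i ∈ (φ.erase x₀).1) ∧ Function.Injective x := by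
    intro x
    rw [Fin.forall_fin_succ, Fin.cons_injective_iff]
    have : ∀ y, y ∈ (φ.erase x₀).1 ↔ y ∈ φ.1 ∧ y ≠ x₀ := fun y => Iff.rfl
    simp only [Fin.cons_zero, Fin.cons_succ, this, mem_range, not_exists, forall_and]
    tauto
  split_ifs with h
  · rw [sumDistinct_eq_tsum]
    refine tsum_congr fun x => ?_
    change (if _ then f (Fin.cons x₀ x) else 0) = _
    refine if_congr ?_ rfl rfl
    exact (key x).trans ⟨fun h => h.2, fun h' => ⟨h, h'⟩⟩
  · refine ENNReal.tsum_eq_zero.mpr fun x => if_neg fun h' => h ((key x).mp h').1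

theorem Config.sumDistinct_erase {d : ℕ} {M : Type*} (φ : Config d M)
    (x₀ : EuclideanSpace ℝ (Fin d) × M) (n : ℕ)
    (f : (Fin n → EuclideanSpace ℝ (Fin d) × M) → ℝ≥0∞) :
    (φ.erase x₀).sumDistinct n f =
      φ.sumDistinct n ({x | ∀ i, x i ≠ x₀}.indicator f) := by
  classical
  rw [sumDistinct_eq_tsum, sumDistinct_eq_tsum]
  refine tsum_congr fun x => ?_
  have : ∀ y, y ∈ (φ.erase x₀).1 ↔ y ∈ φ.1 ∧ y ≠ x₀ := fun y => Iff.rfl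
  simp only [this, forall_and, indicator_apply, mem_ofPred_eq]
  split_ifs <;> tauto

/-! ### Local integrability and translation invariance -/

section Reference

variable {d : ℕ} {M : Type*} [MeasurableSpace M]

/-- The reference measure `ℓ ⊗ ν` on marked locations. -/
noncomputable abbrev refMeasure (d : ℕ) (ν : Measure M) :
    Measure (EuclideanSpace ℝ (Fin d) × M) :=
  (volume : Measure (EuclideanSpace ℝ (Fin d))).prod ν

variable (ν : Measure M) [IsFiniteMeasure ν]

theorem ballMeasure_eq (D : Set M) (r : ℝ) (n : ℕ) :
    ballMeasure (d := d) ν D r n = (Measure.pi fun _ => refMeasure d ν).restrict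
      (univ.pi fun _ => Metric.closedBall 0 r ×ˢ D) :=
  (Measure.restrict_pi_pi _ _).symm

instance sigmaFinite_ballMeasure (D : Set M) (r : ℝ) (n : ℕ) :
    SigmaFinite (ballMeasure (d := d) ν D r n) := by
  unfold ballMeasure
  infer_instance

theorem measurable_shift :
    Measurable fun p : EuclideanSpace ℝ (Fin d) × (EuclideanSpace ℝ (Fin d) × M) =>
      shift p.1 p.2 := by
  unfold shift
  fun_prop

theorem measurePreserving_shift (a : EuclideanSpace ℝ (Fin d)) :
    MeasurePreserving (shift (M := M) a) (refMeasure d ν) (refMeasure d ν) :=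
  (measurePreserving_add_right volume a).prod (MeasurePreserving.id ν)

theorem measurePreserving_shift_pi (a : EuclideanSpace ℝ (Fin d)) (n : ℕ) :
    MeasurePreserving (fun (x : Fin n → EuclideanSpace ℝ (Fin d) × M) i => shift a (x i))
      (Measure.pi fun _ => refMeasure d ν) (Measure.pi fun _ => refMeasure d ν) :=
  measurePreserving_pi _ _ fun _ => measurePreserving_shift ν a

/-- Attaching the mark `b` to the base point `a` and moving the other points along with `a`
preserves the reference measures. -/
theorem measurePreserving_basePoint (n : ℕ) :
    MeasurePreserving
      (fun p : EuclideanSpace ℝ (Fin d) × (M × (Fin n → EuclideanSpace ℝ (Fin d) × M)) =>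
        ((p.1, p.2.1), fun i => shift p.1 (p.2.2 i)))
      (volume.prod (ν.prod (Measure.pi fun _ => refMeasure d ν)))
      ((refMeasure d ν).prod (Measure.pi fun _ => refMeasure d ν)) := by
  have h := (MeasurePreserving.id (volume : Measure (EuclideanSpace ℝ (Fin d)))).skew_product
    (μc := ν.prod (Measure.pi fun _ : Fin n => refMeasure d ν))
    (μd := ν.prod (Measure.pi fun _ : Fin n => refMeasure d ν))
    (g := fun a (y : M × (Fin n → EuclideanSpace ℝ (Fin d) × M)) =>
      (y.1, fun i => shift a (y.2 i))) ?_ ?_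
  · exact ((measurePreserving_prodAssoc volume ν
      (Measure.pi fun _ : Fin n => refMeasure d ν)).symm MeasurableEquiv.prodAssoc).comp h
  · refine (measurable_fst.comp measurable_snd).prodMk (measurable_pi_iff.mpr fun i => ?_)
    exact measurable_shift.comp (measurable_fst.prodMk
      ((measurable_pi_apply i).comp (measurable_snd.comp measurable_snd)))
  · exact ae_of_all _ fun a =>
      ((MeasurePreserving.id ν).prod (measurePreserving_shift_pi ν a n)).map_eq

end Reference

theorem intensity_pos {d : ℕ} {M : Type*}
    {ρ : ∀ n : ℕ, (Fin n → EuclideanSpace ℝ (Fin d) × M) → ℝ≥0}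
    (h : 0 < lamBar ρ univ) (x : EuclideanSpace ℝ (Fin d) × M) : 0 < intensity ρ x :=
  h.trans_le (csInf_le (OrderBot.bddBelow _) ⟨x, by simp, rfl⟩)

theorem lamBar_le_intensity {d : ℕ} {M : Type*}
    (ρ : ∀ n : ℕ, (Fin n → EuclideanSpace ℝ (Fin d) × M) → ℝ≥0) {D : Set M}
    {x : EuclideanSpace ℝ (Fin d) × M} (hx : x.2 ∈ D) : lamBar ρ D ≤ intensity ρ x :=
  csInf_le (OrderBot.bddBelow _) ⟨x, by simp [hx], rfl⟩

/-- A measurable function on `ℝ^d` that is almost everywhere invariant under each translation is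
almost everywhere constant. -/
theorem exists_ae_eq_const_of_translation_invariant {d : ℕ}
    {f : EuclideanSpace ℝ (Fin d) → ℝ} (hf : Measurable f)
    (h : ∀ t : EuclideanSpace ℝ (Fin d), ∀ᵐ a, f (a + t) = f a) :
    ∃ c, ∀ᵐ a, f a = c := by
  have hmeas : MeasurableSet
      {p : EuclideanSpace ℝ (Fin d) × EuclideanSpace ℝ (Fin d) | f (p.2 + p.1) = f p.2} :=
    measurableSet_eq_fun (by fun_prop) (by fun_prop)
  have h1 : ∀ᵐ p : EuclideanSpace ℝ (Fin d) × EuclideanSpace ℝ (Fin d)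
      ∂((volume : Measure _).prod volume), f (p.2 + p.1) = f p.2 :=
    (Measure.ae_prod_mem_iff_ae_ae_mem hmeas).mpr (ae_of_all _ h)
  have h2 := Measure.ae_ae_of_ae_prod
    (Measure.measurePreserving_swap.quasiMeasurePreserving.ae h1)
  -- By Fubini a single `a` serves almost all `t`, and `t ↦ a + t` preserves null sets.
  obtain ⟨a, ha⟩ := h2.exists
  refine ⟨f a, ?_⟩
  have := (measurePreserving_sub_right volume a).quasiMeasurePreserving.ae ha
  filter_upwards [this] with s hs
  simpa using hs

section IRMS

variable {d : ℕ} {M Ω : Type*} [MeasurableSpace M] [MeasurableSpace Ω]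
  {P : Measure Ω} {Y : Ω → Config d M} {ν : Measure M} [IsFiniteMeasure ν]
  {ρ : ∀ n : ℕ, (Fin n → EuclideanSpace ℝ (Fin d) × M) → ℝ≥0}

/-- Finite moments and the Campbell formula make the product densities locally integrable. -/
theorem setLIntegral_density_lt_top (hY : IsIRMS P Y ν ρ) {n : ℕ} (hn : 1 ≤ n) (R : ℝ) :
    ∫⁻ x in univ.pi fun _ => Metric.closedBall 0 R ×ˢ univ, (ρ n x : ℝ≥0∞)
      ∂(Measure.pi fun _ => refMeasure d ν) < ∞ := by
  have hK : MeasurableSet (univ.pi fun _ : Fin n =>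
      (Metric.closedBall (0 : EuclideanSpace ℝ (Fin d)) R ×ˢ (univ : Set M))) :=
    MeasurableSet.univ_pi fun _ => Metric.isClosed_closedBall.measurableSet.prod .univ
  have := hY.density.campbell n hn _ (measurable_one.indicator hK)
  rw [← lintegral_indicator hK]
  calc _ = _ := by
        refine lintegral_congr fun x => ?_
        by_cases hx : x ∈ univ.pi fun _ : Fin n =>
          (Metric.closedBall (0 : EuclideanSpace ℝ (Fin d)) R ×ˢ (univ : Set M))
        · rw [indicator_of_mem hx, indicator_of_mem hx, Pi.one_apply, one_mul]
        · rw [indicator_of_notMem hx, indicator_of_notMem hx, zero_mul]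
    _ = _ := this.symm
    _ ≤ ∫⁻ ω, (((Y ω).1 ∩ Metric.closedBall 0 R ×ˢ univ).encard : ℝ≥0∞) ^ n ∂P :=
        lintegral_mono fun ω => (Y ω).sumDistinct_indicator_le n R
    _ < ∞ := (hY.moments n R).lt_top

theorem lintegral_reweighted_ne_top (hY : IsIRMS P Y ν ρ) (n : ℕ) (R : ℝ) :
    ∫⁻ x, (reweighted ρ n x : ℝ≥0∞) ∂(ballMeasure (d := d) ν univ R n) ≠ ∞ := by
  rcases Nat.eq_zero_or_pos n with rfl | hn
  · simp only [reweighted_zero, ballMeasure]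
    simp
  rw [ballMeasure_eq]
  have hle : ∀ x, (reweighted ρ n x : ℝ≥0∞) ≤
      ((((lamBar ρ univ) ^ n)⁻¹ : ℝ≥0) : ℝ≥0∞) * (ρ n x : ℝ≥0∞) := by
    intro x
    rw [← ENNReal.coe_mul, ENNReal.coe_le_coe, reweighted_of_ne_zero ρ hn.ne', mul_comm,
      div_eq_mul_inv]
    gcongr
    · exact pow_pos hY.lamBar_pos _
    · calc (lamBar ρ univ) ^ n = ∏ _i : Fin n, lamBar ρ univ := by simp
        _ ≤ _ := Finset.prod_le_prod' fun i _ => lamBar_le_intensity ρ (mem_univ _)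
  refine ((lintegral_mono hle).trans_lt ?_).ne
  rw [lintegral_const_mul' _ _ ENNReal.coe_ne_top]
  exact ENNReal.mul_lt_top ENNReal.coe_lt_top (setLIntegral_density_lt_top hY hn R)

theorem integrable_reweighted (hY : IsIRMS P Y ν ρ) (n : ℕ) (R : ℝ) :
    Integrable (fun x => (reweighted ρ n x : ℝ)) (ballMeasure (d := d) ν univ R n) := by
  refine ⟨(measurable_coe_nnreal_real.comp
    (measurable_reweighted ρ hY.density.measurable n)).aestronglyMeasurable, ?_⟩
  rw [hasFiniteIntegral_iff_enorm]
  simpa using (lintegral_reweighted_ne_top hY n R).lt_top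

/-- Fubini in the base point: on `‖a‖ ≤ R` the translated points stay in the ball of radius `r + R`,
where the correlation function is integrable. -/
theorem ae_integrable_Jintegrand_univ (hY : IsIRMS P Y ν ρ) (n : ℕ) {r : ℝ} (hr : 0 ≤ r) (R : ℝ) :
    ∀ᵐ a : EuclideanSpace ℝ (Fin d), a ∈ Metric.closedBall 0 R →
      Integrable (Jintegrand ρ n a) (ν.prod (ballMeasure ν univ r n)) := by
  set K : Set (EuclideanSpace ℝ (Fin d) × M) := Metric.closedBall 0 (r + R) ×ˢ univ with hK
  have hKm : MeasurableSet K := Metric.isClosed_closedBall.measurableSet.prod .univ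
  have : IsFiniteMeasure ((refMeasure d ν).restrict K) := by
    refine ⟨?_⟩
    rw [Measure.restrict_apply_univ, hK, Measure.prod_prod]
    exact ENNReal.mul_lt_top measure_closedBall_lt_top (measure_lt_top _ _)
  have hξ := integrable_correlation ρ (intensity_pos hY.lamBar_pos)
    (m := (refMeasure d ν).restrict K)
    (fun n => integrable_reweighted hY n (r + R)) n
  rw [← Measure.restrict_pi_pi, Measure.prod_restrict] at hξ
  have hT := (measurePreserving_basePoint (d := d) ν n).restrict_preimage
    (hKm.prod (MeasurableSet.univ_pi fun _ : Fin n => hKm))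
  have h1 := hT.integrable_comp_of_integrable hξ
  rw [← ae_restrict_iff' Metric.isClosed_closedBall.measurableSet]
  refine Integrable.prod_right_ae (μ := volume.restrict (Metric.closedBall 0 R))
    (f := fun p => Jintegrand ρ n p.1 p.2) ?_
  refine h1.mono_measure ?_
  rw [ballMeasure_eq, ← Measure.restrict_univ (μ := ν), Measure.prod_restrict,
    Measure.prod_restrict, Measure.restrict_univ]
  refine Measure.restrict_mono ?_ le_rfl
  rintro ⟨a, b, z⟩ ⟨ha, -, hz⟩
  have hR : ‖a‖ ≤ R := by simpa using ha
  have hz' : ∀ i, ‖(z i).1‖ ≤ r := fun i => by simpa using (hz i (mem_univ i)).1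
  refine ⟨⟨?_, mem_univ _⟩, fun i _ => ⟨?_, mem_univ _⟩⟩
  · simpa using hR.trans (le_add_of_nonneg_left hr)
  · simpa [shift] using (norm_add_le _ _).trans (add_le_add (hz' i) hR)

theorem ae_integrable_Jintegrand (hY : IsIRMS P Y ν ρ) :
    ∀ᵐ a : EuclideanSpace ℝ (Fin d), ∀ (n : ℕ) (r : ℝ) (C D : Set M),
      Integrable (Jintegrand ρ n a) ((ν.restrict C).prod (ballMeasure ν D r n)) := by
  have := ae_all_iff.mpr fun n : ℕ => ae_all_iff.mpr fun N : ℕ => ae_all_iff.mpr fun R : ℕ =>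
    ae_integrable_Jintegrand_univ hY n N.cast_nonneg R
  filter_upwards [this] with a ha n r C D
  obtain ⟨N, hN⟩ := exists_nat_ge r
  obtain ⟨R, hR⟩ := exists_nat_ge ‖a‖
  refine (ha n N R (by simpa using hR)).mono_measure ?_
  rw [ballMeasure_eq, ballMeasure_eq, Measure.prod_restrict, ← Measure.restrict_univ (μ := ν),
    Measure.prod_restrict, Measure.restrict_univ]
  refine Measure.restrict_mono (prod_mono (subset_univ _) ?_) le_rfl
  exact pi_mono fun i _ => prod_mono (Metric.closedBall_subset_closedBall hN) (subset_univ _)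

theorem measurable_Jintegrand (hm : ∀ n, Measurable (ρ n)) (n : ℕ) :
    Measurable fun p : EuclideanSpace ℝ (Fin d) ×
      (M × (Fin n → EuclideanSpace ℝ (Fin d) × M)) => Jintegrand ρ n p.1 p.2 :=
  -- Only the measurability of the change of base point is used, so the measure on `M` is arbitrary.
  (measurable_correlation ρ hm (n + 1)).comp
    ((measurable_cons n).comp (measurePreserving_basePoint (0 : Measure M) n).measurable)

theorem ae_Jn_eq_const (hY : IsIRMS P Y ν ρ) {C D : Set M} (n : ℕ) (hn : 1 ≤ n) (r : ℝ) :
    ∃ c : ℝ, ∀ᵐ a : EuclideanSpace ℝ (Fin d), Jn ν ρ C D n a r = c := by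
  refine exists_ae_eq_const_of_translation_invariant ?_ fun t => ?_
  · exact ((measurable_Jintegrand hY.density.measurable n).stronglyMeasurable.integral_prod_right'
      (ν := (ν.restrict C).prod (ballMeasure ν D r n))).measurable
  · have h1 := hY.translation_invariant (n + 1) (by omega) t
    have h2 := Measure.ae_ae_of_ae_prod (((measurePreserving_cons (refMeasure d ν) n).comp
      (measurePreserving_basePoint ν n)).quasiMeasurePreserving.ae h1)
    filter_upwards [h2] with a ha
    refine integral_congr_ae ?_
    have hac : (ν.restrict C).prod (ballMeasure ν D r n) ≪
        ν.prod (Measure.pi fun _ : Fin n => refMeasure d ν) := by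
      rw [ballMeasure_eq, Measure.prod_restrict]
      exact Measure.restrict_le_self.absolutelyContinuous
    filter_upwards [hac.ae_le ha] with y hy
    refine Eq.trans ?_ hy
    unfold Jintegrand
    congr 1
    funext i
    cases i using Fin.cases <;> simp [shift, add_assoc]

/-- The reweighted product densities inherit translation invariance from the correlation functions of
the blocks. -/
theorem ae_reweighted_shift (hY : IsIRMS P Y ν ρ) (n : ℕ) (a : EuclideanSpace ℝ (Fin d)) :
    ∀ᵐ x ∂(Measure.pi fun _ : Fin n => refMeasure d ν),
      reweighted ρ n (fun i => shift a (x i)) = reweighted ρ n x := by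
  have h : ∀ E : Finset (Fin n), ∀ᵐ x ∂(Measure.pi fun _ : Fin n => refMeasure d ν),
      blockCorrelation ρ (fun i => shift a (x i)) E = blockCorrelation ρ x E := by
    intro E
    by_cases hE : E.card ≤ 1
    · exact ae_of_all _ fun x => by
        simp only [blockCorrelation, correlation_of_le_one ρ hE]
    · exact (Measure.quasiMeasurePreserving_fst.comp (measurePreserving_restrict_coords
        (refMeasure d ν) E).quasiMeasurePreserving).ae
        (hY.translation_invariant E.card (by omega) a)
  filter_upwards [ae_all_iff.mpr h] with x hx
  apply NNReal.coe_injective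
  rw [reweighted_eq_partitionSum ρ (intensity_pos hY.lamBar_pos),
    reweighted_eq_partitionSum ρ (intensity_pos hY.lamBar_pos)]
  congr 1
  exact funext hx

end IRMS

/-! ### Measurability of sums over configurations -/

section Counting

universe u
variable {d : ℕ} {M : Type u}

theorem Config.countable (φ : Config d M) : φ.1.Countable := by
  have : φ.1 ⊆ ⋃ N : ℕ, φ.1 ∩ Metric.closedBall 0 N ×ˢ univ := by
    intro x hx
    obtain ⟨N, hN⟩ := exists_nat_ge ‖x.1‖
    exact mem_iUnion.mpr ⟨N, hx, by simpa using hN, mem_univ _⟩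
  exact (countable_iUnion fun N : ℕ => (φ.2.1 N).countable).mono this

variable [MeasurableSpace M]

theorem measurable_encard_inter {A : Set (EuclideanSpace ℝ (Fin d) × M)} (hA : MeasurableSet A) :
    Measurable fun φ : Config d M => ((φ.1 ∩ A).encard : ℝ≥0∞) := by
  have h : @Measurable _ _ _ ⊤ fun φ : Config d M => (φ.1 ∩ A).encard :=
    Measurable.mono (comap_measurable _)
      (le_iSup₂_of_le (f := fun (A : Set (EuclideanSpace ℝ (Fin d) × M)) (_ : MeasurableSet A) =>
        MeasurableSpace.comap (fun φ : Config d M => (φ.1 ∩ A).encard) ⊤) A hA le_rfl) le_rfl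
  exact Measurable.comp (g := fun n : ℕ∞ => (n : ℝ≥0∞)) measurable_from_top h

variable [MeasurableSingletonClass M]

/-- The kernel sending a configuration to the counting measure on its points. -/
noncomputable def countKernel (d : ℕ) (M : Type u) [MeasurableSpace M]
    [MeasurableSingletonClass M] : Kernel (Config d M) (EuclideanSpace ℝ (Fin d) × M) where
  toFun φ := Measure.count.restrict φ.1
  measurable' := by
    refine Measure.measurable_of_measurable_coe _ fun A hA => ?_
    convert! measurable_encard_inter hA using 2 with φ
    rw [Measure.restrict_apply hA, Measure.count_apply (hA.inter φ.countable.measurableSet),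
      inter_comm]

theorem countKernel_apply (φ : Config d M) {A : Set (EuclideanSpace ℝ (Fin d) × M)}
    (hA : MeasurableSet A) : countKernel d M φ A = ((φ.1 ∩ A).encard : ℝ≥0∞) := by
  change Measure.count.restrict φ.1 A = _
  rw [Measure.restrict_apply hA, Measure.count_apply (hA.inter φ.countable.measurableSet),
    inter_comm]

theorem lintegral_countKernel (φ : Config d M) (f : EuclideanSpace ℝ (Fin d) × M → ℝ≥0∞) :
    ∫⁻ x, f x ∂(countKernel d M φ) = ∑' x : φ.1, f x := by
  change ∫⁻ x in φ.1, f x ∂Measure.count = _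
  rw [lintegral_countable _ φ.countable]
  simp

/-- The counting kernel is not uniformly finite on bounded regions, but it is the countable sum of
the finite kernels that record the points of an annulus provided that there are exactly `m`. -/
instance isSFiniteKernel_countKernel : IsSFiniteKernel (countKernel d M) := by
  classical
  set A : ℕ → Set (EuclideanSpace ℝ (Fin d) × M) := fun k => {x | ⌊‖x.1‖⌋₊ = k} with hAdef
  have hA : ∀ k, MeasurableSet (A k) := fun k =>
    (Nat.measurable_floor.comp (measurable_norm.comp measurable_fst)) (measurableSet_singleton k)
  have hS : ∀ k m : ℕ, MeasurableSet {φ : Config d M | countKernel d M φ (A k) = m} :=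
    fun k m => (Kernel.measurable_coe _ (hA k)) (measurableSet_singleton _)
  let K : ℕ × ℕ → Kernel (Config d M) (EuclideanSpace ℝ (Fin d) × M) := fun p =>
    Kernel.piecewise (hS p.1 p.2) ((countKernel d M).restrict (hA p.1)) 0
  have hK : ∀ p φ B, MeasurableSet B → K p φ B =
      if countKernel d M φ (A p.1) = p.2 then countKernel d M φ (B ∩ A p.1) else 0 := by
    intro p φ B hB
    simp only [K, Kernel.piecewise_apply, mem_ofPred_eq]
    split_ifs
    · rw [Kernel.restrict_apply, Measure.restrict_apply hB]
    · simp
  have hfin : ∀ φ : Config d M, ∀ k, ∃ m : ℕ, countKernel d M φ (A k) = m := by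
    intro φ k
    have : (φ.1 ∩ A k).Finite := by
      refine (φ.2.1 (k + 1)).subset fun x hx => ⟨hx.1, ?_, mem_univ _⟩
      have h : ⌊‖x.1‖⌋₊ = k := hx.2
      have := (Nat.lt_floor_add_one ‖x.1‖).le
      rw [h] at this
      simpa using this
    exact ⟨this.toFinset.card, by
      rw [countKernel_apply φ (hA k), this.encard_eq_coe_toFinset_card]; rfl⟩
  have hsum : countKernel d M = Kernel.sum K := by
    ext φ B hB
    rw [Kernel.sum_apply' _ _ hB, ENNReal.tsum_prod']
    simp_rw [hK _ _ _ hB]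
    have h1 : ∀ k, ∑' m : ℕ, (if countKernel d M φ (A k) = m then
        countKernel d M φ (B ∩ A k) else 0) = countKernel d M φ (B ∩ A k) := by
      intro k
      obtain ⟨m, hm⟩ := hfin φ k
      rw [hm, tsum_eq_single m]
      · simp
      · intro m' hm'
        rw [if_neg]
        exact fun h => hm' (by exact_mod_cast h.symm)
    simp_rw [h1]
    rw [← measure_iUnion]
    · congr 1
      ext x
      simp [hAdef]
    · intro i j hij
      refine Set.disjoint_left.mpr fun x hx hx' => hij ?_
      exact (show ⌊‖x.1‖⌋₊ = i from hx.2).symm.trans hx'.2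
    · exact fun k => hB.inter (hA k)
  rw [hsum]
  have : ∀ p, IsFiniteKernel (K p) := by
    intro p
    refine ⟨⟨(p.2 : ℝ≥0∞), ENNReal.natCast_lt_top _, fun φ => ?_⟩⟩
    rw [hK _ _ _ .univ]
    split_ifs with h
    · rw [univ_inter, h]
    · exact zero_le
  exact Kernel.isSFiniteKernel_sum

/-- Sums over the points of a measurably varying configuration are measurable, because the counting
kernel is s-finite. -/
theorem measurable_tsum_config {Z : Type*} [MeasurableSpace Z] {Φ : Z → Config d M}
    (hΦ : Measurable Φ) {g : Z × (EuclideanSpace ℝ (Fin d) × M) → ℝ≥0∞} (hg : Measurable g) :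
    Measurable fun z => ∑' x : (Φ z).1, g (z, x) := by
  have := Measurable.lintegral_kernel_prod_right' (κ := (countKernel d M).comap Φ hΦ) hg
  convert! this using 2 with z
  rw [Kernel.comap_apply, lintegral_countKernel]

theorem measurable_sumDistinct [TopologicalSpace M] [PolishSpace M] [BorelSpace M] {n : ℕ} {Z : Type u} [MeasurableSpace Z]
    {Φ : Z → Config d M}
    (hΦ : Measurable Φ) {g : Z × (Fin n → EuclideanSpace ℝ (Fin d) × M) → ℝ≥0∞}
    (hg : Measurable g) : Measurable fun z => (Φ z).sumDistinct n fun x => g (z, x) := by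
  induction n generalizing Z with
  | zero =>
    simp_rw [Config.sumDistinct_zero]
    exact hg.comp (measurable_id.prodMk measurable_const)
  | succ n ih =>
    simp_rw [Config.sumDistinct_succ, Config.sumDistinct_erase]
    refine measurable_tsum_config hΦ (g := fun p => (Φ p.1).sumDistinct n
      ({x | ∀ i, x i ≠ p.2}.indicator fun x => g (p.1, Fin.cons p.2 x))) ?_
    refine ih (Φ := fun p : Z × (EuclideanSpace ℝ (Fin d) × M) => Φ p.1) (hΦ.comp measurable_fst)
      (g := {q : (Z × (EuclideanSpace ℝ (Fin d) × M)) × (Fin n → EuclideanSpace ℝ (Fin d) × M) |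
        ∀ i, q.2 i ≠ q.1.2}.indicator fun q => g (q.1.1, Fin.cons q.1.2 q.2)) ?_
    refine Measurable.indicator (hg.comp ((measurable_fst.comp measurable_fst).prodMk
      ((measurable_cons n).comp ((measurable_snd.comp measurable_fst).prodMk measurable_snd)))) ?_
    simp_rw [ofPred_forall]
    refine MeasurableSet.iInter fun i => MeasurableSet.compl ?_
    exact measurableSet_eq_fun ((measurable_pi_apply i).comp measurable_snd)
      (measurable_snd.comp measurable_fst)

end Counting

/-! ### Product densities of the reduced Palm measures -/

/-- Finite intersections of a countable generating sequence form a countable π-system. -/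
theorem exists_countable_piSystem (α : Type*) [m : MeasurableSpace α]
    [MeasurableSpace.CountablyGenerated α] :
    ∃ S : Set (Set α), S.Countable ∧ IsPiSystem S ∧ MeasurableSpace.generateFrom S = m ∧
      univ ∈ S := by
  let A := MeasurableSpace.natGeneratingSequence α
  refine ⟨range fun F : Finset ℕ => ⋂ i ∈ F, A i, countable_range _, ?_, le_antisymm ?_ ?_,
    ∅, by simp⟩
  · rintro _ ⟨F, rfl⟩ _ ⟨G, rfl⟩ -
    exact ⟨F ∪ G, by ext x; simp [or_imp, forall_and]⟩
  · refine MeasurableSpace.generateFrom_le ?_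
    rintro _ ⟨F, rfl⟩
    exact F.measurableSet_biInter fun i _ => MeasurableSpace.measurableSet_natGeneratingSequence i
  · conv_lhs => rw [← MeasurableSpace.generateFrom_natGeneratingSequence α]
    refine MeasurableSpace.generateFrom_mono ?_
    rintro _ ⟨i, rfl⟩
    exact ⟨{i}, by simp [A]⟩

theorem ae_lintegral_density_lt_top {d : ℕ} {M Ω : Type*} [MeasurableSpace M]
    [MeasurableSpace Ω] {P : Measure Ω} {Y : Ω → Config d M} {ν : Measure M} [IsFiniteMeasure ν]
    {ρ : ∀ n : ℕ, (Fin n → EuclideanSpace ℝ (Fin d) × M) → ℝ≥0} (hY : IsIRMS P Y ν ρ) (n : ℕ) (R : ℕ) :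
    ∀ᵐ x ∂(refMeasure d ν), x ∈ Metric.closedBall (0 : EuclideanSpace ℝ (Fin d)) R ×ˢ univ →
      ∫⁻ y in univ.pi fun _ => Metric.closedBall 0 R ×ˢ univ, (ρ (n + 1) (Fin.cons x y) : ℝ≥0∞)
        ∂(Measure.pi fun _ => refMeasure d ν) < ∞ := by
  set K : Set (EuclideanSpace ℝ (Fin d) × M) := Metric.closedBall 0 R ×ˢ univ with hK
  have hKm : MeasurableSet K := Metric.isClosed_closedBall.measurableSet.prod .univ
  have h := setLIntegral_density_lt_top hY (n := n + 1) (by omega) R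
  have hm : Measurable fun w => (ρ (n + 1) w : ℝ≥0∞) :=
    measurable_coe_nnreal_ennreal.comp (hY.density.measurable (n + 1))
  rw [Measure.restrict_pi_pi, ← (measurePreserving_cons ((refMeasure d ν).restrict K)
    n).lintegral_comp hm] at h
  have hc : Measurable fun p : (EuclideanSpace ℝ (Fin d) × M) ×
      (Fin n → EuclideanSpace ℝ (Fin d) × M) => (ρ (n + 1) (Fin.cons p.1 p.2) : ℝ≥0∞) :=
    hm.comp (measurable_cons n)
  rw [lintegral_prod _ hc.aemeasurable] at h
  rw [← ae_restrict_iff' hKm, Measure.restrict_pi_pi]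
  exact ae_lt_top hc.lintegral_prod_right' h.ne

section Palm

universe u
variable {d : ℕ} {M : Type u} [TopologicalSpace M] [PolishSpace M] [MeasurableSpace M]
  [BorelSpace M]

theorem measurable_sumDistinct_config {n : ℕ}
    {f : (Fin n → EuclideanSpace ℝ (Fin d) × M) → ℝ≥0∞} (hf : Measurable f) :
    Measurable fun φ : Config d M => φ.sumDistinct n f :=
  measurable_sumDistinct (Φ := id) measurable_id (g := fun p => f p.2) (hf.comp measurable_snd)

/-- The kernel sending a configuration to its `n`-th factorial measure, the counting measure on
`n`-tuples of distinct points. -/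
noncomputable def factorialKernel (d : ℕ) (M : Type u) [TopologicalSpace M] [PolishSpace M]
    [MeasurableSpace M] [BorelSpace M] (n : ℕ) :
    Kernel (Config d M) (Fin n → EuclideanSpace ℝ (Fin d) × M) where
  toFun φ := Measure.sum fun x : {x : Fin n → EuclideanSpace ℝ (Fin d) × M //
    (∀ i, x i ∈ φ.1) ∧ Function.Injective x} => Measure.dirac x.1
  measurable' := by
    refine Measure.measurable_of_measurable_coe _ fun A hA => ?_
    convert! measurable_sumDistinct_config (measurable_one.indicator hA) using 2 with φ
    rw [Measure.sum_apply _ hA]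
    exact tsum_congr fun x => Measure.dirac_apply' _ hA

theorem lintegral_factorialKernel {n : ℕ} (φ : Config d M)
    {f : (Fin n → EuclideanSpace ℝ (Fin d) × M) → ℝ≥0∞} (hf : Measurable f) :
    ∫⁻ x, f x ∂(factorialKernel d M n φ) = φ.sumDistinct n f := by
  change ∫⁻ x, f x ∂(Measure.sum _) = _
  rw [lintegral_sum_measure]
  exact tsum_congr fun x => lintegral_dirac' _ hf

variable {Ω : Type*} [MeasurableSpace Ω]
  {P : Measure Ω} {Y : Ω → Config d M} {ν : Measure M} [IsFiniteMeasure ν]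
  {ρ : ∀ n : ℕ, (Fin n → EuclideanSpace ℝ (Fin d) × M) → ℝ≥0}
  {κ : Kernel (EuclideanSpace ℝ (Fin d) × M) (Config d M)}

/-- The Campbell-Mecke formula combined with the Campbell formula of order `n + 1`. -/
theorem lintegral_palm_sumDistinct (hY : IsIRMS P Y ν ρ) (hκ : IsReducedPalm P Y ν ρ κ) (n : ℕ)
    {g : EuclideanSpace ℝ (Fin d) × M → ℝ≥0∞} (hg : Measurable g)
    {f : (Fin n → EuclideanSpace ℝ (Fin d) × M) → ℝ≥0∞} (hf : Measurable f) :
    ∫⁻ x, g x * ((∫⁻ φ, φ.sumDistinct n f ∂κ x) * intensity ρ x) ∂(refMeasure d ν) =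
      ∫⁻ x, g x * (∫⁻ y, f y * ρ (n + 1) (Fin.cons x y) ∂(Measure.pi fun _ => refMeasure d ν))
        ∂(refMeasure d ν) := by
  have hS := measurable_sumDistinct_config (d := d) hf
  have h1 := hκ (fun p => g p.1 * p.2.sumDistinct n f)
    ((hg.comp measurable_fst).mul (hS.comp measurable_snd))
  have hF : Measurable fun w : Fin (n + 1) → EuclideanSpace ℝ (Fin d) × M =>
      g (w 0) * f (Fin.tail w) :=
    (hg.comp (measurable_pi_apply 0)).mul (hf.comp (measurable_pi_iff.mpr fun i =>
      measurable_pi_apply _))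
  have h2 := hY.density.campbell (n + 1) (by omega) _ hF
  have h3 : ∀ ω, (Y ω).sumDistinct (n + 1) (fun w => g (w 0) * f (Fin.tail w)) =
      ∑' x : (Y ω).1, g x.1 * ((Y ω).erase x.1).sumDistinct n f := by
    intro ω
    rw [Config.sumDistinct_succ]
    refine tsum_congr fun x => ?_
    simp only [Fin.cons_zero, Fin.tail_cons]
    exact ENNReal.tsum_mul_left
  simp_rw [h3] at h2
  have h4 : ∫⁻ x, g x * ((∫⁻ φ, φ.sumDistinct n f ∂κ x) * intensity ρ x) ∂(refMeasure d ν) =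
      ∫⁻ x, (∫⁻ φ, g x * φ.sumDistinct n f ∂κ x) * intensity ρ x ∂(refMeasure d ν) := by
    refine lintegral_congr fun x => ?_
    rw [lintegral_const_mul _ hS, mul_assoc]
  rw [h4, ← h1, h2, ← (measurePreserving_cons (refMeasure d ν) n).lintegral_comp,
    lintegral_prod]
  · refine lintegral_congr fun x => ?_
    simp only [Fin.cons_zero, Fin.tail_cons, mul_assoc]
    rw [lintegral_const_mul]
    exact hf.mul (measurable_coe_nnreal_ennreal.comp ((hY.density.measurable _).comp
      ((measurable_cons n).comp measurable_prodMk_left)))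
  · exact ((hF.mul (measurable_coe_nnreal_ennreal.comp (hY.density.measurable _))).comp
      (measurable_cons n)).aemeasurable
  · exact hF.mul (measurable_coe_nnreal_ennreal.comp (hY.density.measurable _))

/-- For a fixed test function, the product densities of the reduced Palm measures. -/
theorem ae_palm_sumDistinct (hY : IsIRMS P Y ν ρ) [IsMarkovKernel κ]
    (hκ : IsReducedPalm P Y ν ρ κ) (n : ℕ)
    {f : (Fin n → EuclideanSpace ℝ (Fin d) × M) → ℝ≥0∞} (hf : Measurable f) :
    ∀ᵐ x ∂(refMeasure d ν), (∫⁻ φ, φ.sumDistinct n f ∂κ x) * intensity ρ x =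
      ∫⁻ y, f y * ρ (n + 1) (Fin.cons x y) ∂(Measure.pi fun _ => refMeasure d ν) := by
  have hS := measurable_sumDistinct_config (d := d) hf
  refine ae_eq_of_forall_setLIntegral_eq_of_sigmaFinite ?_ ?_ fun s hs _ => ?_
  · exact hS.lintegral_kernel.mul (measurable_coe_nnreal_ennreal.comp
      (measurable_intensity ρ hY.density.measurable))
  · exact Measurable.lintegral_prod_right' (f := fun p : (EuclideanSpace ℝ (Fin d) × M) ×
        (Fin n → EuclideanSpace ℝ (Fin d) × M) => f p.2 * ρ (n + 1) (Fin.cons p.1 p.2))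
      ((hf.comp measurable_snd).mul (measurable_coe_nnreal_ennreal.comp
        ((hY.density.measurable _).comp (measurable_cons n))))
  · have := lintegral_palm_sumDistinct hY hκ n (measurable_one.indicator hs) hf
    rw [← lintegral_indicator hs, ← lintegral_indicator hs]
    convert this using 3 with x x <;>
    · by_cases hx : x ∈ s <;> simp [hx]

/-- Almost every reduced Palm measure `P^{!x}` has the product densities `ρ^(n+1)(x, ·) / λ(x)`.
The exceptional set does not depend on the test function: both sides define measures, which on
bounded sets are finite and so are determined by a countable generating π-system. -/
theorem ae_forall_palm_sumDistinct (hY : IsIRMS P Y ν ρ) [IsMarkovKernel κ]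
    (hκ : IsReducedPalm P Y ν ρ κ) :
    ∀ᵐ x ∂(refMeasure d ν), ∀ (n : ℕ) (f : (Fin n → EuclideanSpace ℝ (Fin d) × M) → ℝ≥0∞),
      Measurable f → (∫⁻ φ, φ.sumDistinct n f ∂κ x) * intensity ρ x =
        ∫⁻ y, f y * ρ (n + 1) (Fin.cons x y) ∂(Measure.pi fun _ => refMeasure d ν) := by
  refine ae_all_iff.mpr fun n => ?_
  obtain ⟨S, hSc, hSpi, hSgen, hSuniv⟩ :=
    exists_countable_piSystem (Fin n → EuclideanSpace ℝ (Fin d) × M)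
  have hSm : ∀ A ∈ S, MeasurableSet A := fun A hA =>
    hSgen ▸ MeasurableSpace.measurableSet_generateFrom hA
  let K : ℕ → Set (Fin n → EuclideanSpace ℝ (Fin d) × M) := fun R =>
    univ.pi fun _ => Metric.closedBall 0 R ×ˢ univ
  have hKm : ∀ R, MeasurableSet (K R) := fun R =>
    MeasurableSet.univ_pi fun _ => Metric.isClosed_closedBall.measurableSet.prod .univ
  have hKmono : Monotone K := fun R R' h => pi_mono fun i _ =>
    prod_mono (Metric.closedBall_subset_closedBall (by exact_mod_cast h)) subset_rfl
  have h1 : ∀ᵐ x ∂(refMeasure d ν), ∀ R : ℕ, ∀ A ∈ S,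
      (∫⁻ φ, φ.sumDistinct n ((A ∩ K R).indicator 1) ∂κ x) * intensity ρ x =
        ∫⁻ y, (A ∩ K R).indicator 1 y * ρ (n + 1) (Fin.cons x y)
          ∂(Measure.pi fun _ => refMeasure d ν) :=
    ae_all_iff.mpr fun R => (ae_ball_iff hSc).mpr fun A hA =>
      ae_palm_sumDistinct hY hκ n (measurable_one.indicator ((hSm A hA).inter (hKm R)))
  filter_upwards [h1, ae_all_iff.mpr fun R => ae_lintegral_density_lt_top hY n R] with x hx hfin
  have hρm : Measurable fun y : Fin n → EuclideanSpace ℝ (Fin d) × M =>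
      (ρ (n + 1) (Fin.cons x y) : ℝ≥0∞) :=
    measurable_coe_nnreal_ennreal.comp ((hY.density.measurable _).comp
      ((measurable_cons n).comp measurable_prodMk_left))
  -- Both sides are integrals against measures `α` and `β`; these agree on bounded sets.
  set α : Measure (Fin n → EuclideanSpace ℝ (Fin d) × M) :=
    (intensity ρ x : ℝ≥0∞) • (factorialKernel d M n ∘ₘ κ x) with hα
  set β : Measure (Fin n → EuclideanSpace ℝ (Fin d) × M) :=
    (Measure.pi fun _ => refMeasure d ν).withDensity fun y => ρ (n + 1) (Fin.cons x y) with hβ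
  have hαint : ∀ f, Measurable f → ∫⁻ y, f y ∂α =
      (∫⁻ φ, φ.sumDistinct n f ∂κ x) * intensity ρ x := by
    intro f hf
    rw [hα, lintegral_smul_measure, Measure.lintegral_bind (Kernel.aemeasurable _)
      hf.aemeasurable, smul_eq_mul, mul_comm]
    simp_rw [lintegral_factorialKernel _ hf]
  have hβint : ∀ f, Measurable f → ∫⁻ y, f y ∂β =
      ∫⁻ y, f y * ρ (n + 1) (Fin.cons x y) ∂(Measure.pi fun _ => refMeasure d ν) := by
    intro f hf
    rw [hβ, lintegral_withDensity_eq_lintegral_mul _ hρm hf]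
    simp_rw [Pi.mul_apply, mul_comm]
  have hS : ∀ R : ℕ, ∀ A ∈ S, α (A ∩ K R) = β (A ∩ K R) := by
    intro R A hA
    have hm := (hSm A hA).inter (hKm R)
    rw [← lintegral_indicator_one hm, ← lintegral_indicator_one hm,
      hαint _ (measurable_one.indicator hm), hβint _ (measurable_one.indicator hm)]
    exact hx R A hA
  have hβfin : ∀ R, β (K R) < ∞ := by
    intro R
    obtain ⟨N, hN⟩ := exists_nat_ge ‖x.1‖
    refine (measure_mono (hKmono (le_max_left R N))).trans_lt ?_
    rw [hβ, withDensity_apply _ (hKm _)]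
    refine hfin (max R N) ⟨?_, mem_univ _⟩
    rw [mem_closedBall_zero_iff]
    exact hN.trans (by exact_mod_cast le_max_right R N)
  have hαβ : α = β := by
    refine (Measure.ext_iff_of_iUnion_eq_univ (s := K) ?_).mpr fun R => ?_
    · refine eq_univ_of_forall fun y => ?_
      obtain ⟨N, hN⟩ := exists_nat_ge (∑ i, ‖(y i).1‖)
      refine mem_iUnion.mpr ⟨N, fun i _ => ⟨?_, mem_univ _⟩⟩
      rw [mem_closedBall_zero_iff]
      exact (Finset.single_le_sum (f := fun i => ‖(y i).1‖) (fun i _ => norm_nonneg _)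
        (Finset.mem_univ i)).trans hN
    · have hu : α (K R) = β (K R) := by simpa using hS R univ hSuniv
      have : IsFiniteMeasure (α.restrict (K R)) :=
        ⟨by rw [Measure.restrict_apply_univ, hu]; exact hβfin R⟩
      refine ext_of_generate_finite S hSgen.symm hSpi (fun A hA => ?_) ?_
      · rw [Measure.restrict_apply (hSm A hA), Measure.restrict_apply (hSm A hA), hS R A hA]
      · rw [Measure.restrict_apply_univ, Measure.restrict_apply_univ, hu]
  intro f hf
  rw [← hαint f hf, ← hβint f hf, hαβ]

end Palm

/-! ### Expansion of generating functionals -/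

/-- Each `n`-subset of `s` has `n!` enumerations. -/
theorem sum_injective_prod {X R : Type*} [DecidableEq X] [CommSemiring R] (s : Finset X) (f : X → R)
    (n : ℕ) [DecidablePred (Function.Injective : (Fin n → X) → Prop)] :
    ∑ x ∈ (Fintype.piFinset fun _ : Fin n => s) with Function.Injective x, ∏ i, f (x i) =
      n.factorial * ∑ t ∈ s.powersetCard n, ∏ x ∈ t, f x := by
  classical
  rw [← Finset.sum_fiberwise_of_maps_to (t := s.powersetCard n)
    (g := fun x : Fin n → X => Finset.univ.image x), Finset.mul_sum]
  · refine Finset.sum_congr rfl fun t ht => ?_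
    obtain ⟨hts, htn⟩ := Finset.mem_powersetCard.mp ht
    have hcard : (((Fintype.piFinset fun _ : Fin n => s).filter Function.Injective).filter
        fun x => Finset.univ.image x = t).card = n.factorial := by
      have : Fintype.card (Fin n ↪ t) = n.factorial := by
        simp [Fintype.card_embedding_eq, htn, Nat.descFactorial_self]
      rw [← this, ← Finset.card_univ]
      symm
      refine Finset.card_nbij (fun e i => (e i : X)) ?_ ?_ ?_
      · intro e _
        have hinj : Function.Injective fun i => (e i : X) :=
          Subtype.val_injective.comp e.injective
        refine Finset.mem_filter.mpr ⟨Finset.mem_filter.mpr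
          ⟨Fintype.mem_piFinset.mpr fun i => hts (e i).2, hinj⟩, ?_⟩
        refine Finset.eq_of_subset_of_card_le ?_ ?_
        · exact Finset.image_subset_iff.mpr fun i _ => (e i).2
        · rw [Finset.card_image_of_injective _ hinj, htn]
          simp
      · intro e _ e' _ h
        ext i
        exact congrFun h i
      · intro x hx
        obtain ⟨hx1, hx2⟩ := Finset.mem_filter.mp hx
        have hxi := (Finset.mem_filter.mp hx1).2
        refine ⟨⟨fun i => ⟨x i, hx2 ▸ Finset.mem_image_of_mem _ (Finset.mem_univ i)⟩,
          fun i j h => hxi (congrArg Subtype.val h)⟩, Finset.mem_coe.mpr (Finset.mem_univ _), rfl⟩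
    rw [Finset.sum_congr rfl (g := fun _ => ∏ x ∈ t, f x), Finset.sum_const, hcard, nsmul_eq_mul]
    intro x hx
    obtain ⟨hx1, hx2⟩ := Finset.mem_filter.mp hx
    have hxi := (Finset.mem_filter.mp hx1).2
    rw [← hx2, Finset.prod_image fun i _ j _ h => hxi h]
  · intro x hx
    obtain ⟨hx1, hx2⟩ := Finset.mem_filter.mp hx
    refine Finset.mem_powersetCard.mpr ⟨Finset.image_subset_iff.mpr fun i _ =>
      Fintype.mem_piFinset.mp hx1 i, ?_⟩
    rw [Finset.card_image_of_injective _ hx2]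
    simp

/-- The elementary symmetric function of degree `n` of the values of `u` at the points of a
configuration. -/
noncomputable def Config.esymm {d : ℕ} {M : Type*} (φ : Config d M)
    (u : EuclideanSpace ℝ (Fin d) × M → ℝ) (n : ℕ) : ℝ≥0∞ :=
  φ.sumDistinct n (fun x => ∏ i, ENNReal.ofReal (u (x i))) / n.factorial

theorem Config.esymm_eq {d : ℕ} {M : Type*} (φ : Config d M)
    {u : EuclideanSpace ℝ (Fin d) × M → ℝ} (h0 : ∀ x, 0 ≤ u x)
    (s : Finset (EuclideanSpace ℝ (Fin d) × M)) (hs : ∀ x ∈ s, x ∈ φ.1)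
    (hu : ∀ x ∈ φ.1, u x ≠ 0 → x ∈ s) (n : ℕ) :
    φ.esymm u n = ENNReal.ofReal (∑ t ∈ s.powersetCard n, ∏ x ∈ t, u x) := by
  classical
  unfold Config.esymm
  rw [φ.sumDistinct_eq_sum n _ s hs, sum_injective_prod s fun x => ENNReal.ofReal (u x), mul_comm,
    ENNReal.mul_div_cancel_right (by exact_mod_cast n.factorial_ne_zero)
      (ENNReal.natCast_ne_top _),
    ENNReal.ofReal_sum_of_nonneg fun t _ => Finset.prod_nonneg fun x _ => h0 x]
  · exact Finset.sum_congr rfl fun t _ => (ENNReal.ofReal_prod_of_nonneg fun x _ => h0 x).symm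
  · intro x hx hne i
    refine hu _ (hx i) fun h => hne ?_
    exact Finset.prod_eq_zero (Finset.mem_univ i) (by simp [h])

/-- Pathwise expansion of `∏ (1 - u x)`; only finitely many terms are non-zero. -/
theorem Config.hasSum_esymm {d : ℕ} {M : Type*} (φ : Config d M)
    {u : EuclideanSpace ℝ (Fin d) × M → ℝ} (h0 : ∀ x, 0 ≤ u x) {R : ℝ}
    (hR : ∀ x, u x ≠ 0 → x ∈ Metric.closedBall (0 : EuclideanSpace ℝ (Fin d)) R ×ˢ univ) :
    HasSum (fun n => (-1) ^ n * (φ.esymm u n).toReal) (∏ᶠ x ∈ φ.1, (1 - u x)) := by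
  classical
  have hfin := φ.2.1 R
  have hs : ∀ x ∈ hfin.toFinset, x ∈ φ.1 := fun x hx => ((Set.Finite.mem_toFinset _).mp hx).1
  have hu : ∀ x ∈ φ.1, u x ≠ 0 → x ∈ hfin.toFinset := fun x hx h =>
    (Set.Finite.mem_toFinset _).mpr ⟨hx, hR x h⟩
  have hprod : ∏ᶠ x ∈ φ.1, (1 - u x) = ∏ x ∈ hfin.toFinset, (1 - u x) := by
    refine finprod_mem_eq_prod_of_inter_mulSupport_eq _ ?_
    ext x
    constructor
    · rintro ⟨hx, h⟩
      exact ⟨hu x hx fun h' => h (by simp [h']), h⟩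
    · rintro ⟨hx, h⟩
      exact ⟨hs x hx, h⟩
  have hterm : ∀ n, (φ.esymm u n).toReal =
      ∑ t ∈ hfin.toFinset.powersetCard n, ∏ x ∈ t, u x := fun n => by
    rw [φ.esymm_eq h0 _ hs hu, ENNReal.toReal_ofReal
      (Finset.sum_nonneg fun t _ => Finset.prod_nonneg fun x _ => h0 x)]
  simp_rw [hterm]
  have hexp : ∏ x ∈ hfin.toFinset, (1 - u x) = ∑ n ∈ Finset.range (hfin.toFinset.card + 1),
      (-1) ^ n * ∑ t ∈ hfin.toFinset.powersetCard n, ∏ x ∈ t, u x := by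
    simp_rw [sub_eq_add_neg]
    rw [Finset.prod_one_add, Finset.sum_powerset]
    refine Finset.sum_congr rfl fun n _ => ?_
    rw [Finset.mul_sum]
    refine Finset.sum_congr rfl fun t ht => ?_
    rw [Finset.prod_neg, (Finset.mem_powersetCard.mp ht).2]
  rw [hprod, hexp]
  refine hasSum_sum_of_ne_finset_zero fun n hn => ?_
  rw [Finset.powersetCard_eq_empty.mpr (by simpa using hn)]
  simp

theorem Config.esymm_ne_top {d : ℕ} {M : Type*} (φ : Config d M)
    {u : EuclideanSpace ℝ (Fin d) × M → ℝ} (h0 : ∀ x, 0 ≤ u x) {R : ℝ}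
    (hR : ∀ x, u x ≠ 0 → x ∈ Metric.closedBall (0 : EuclideanSpace ℝ (Fin d)) R ×ˢ univ) (n : ℕ) :
    φ.esymm u n ≠ ∞ := by
  have hfin := φ.2.1 R
  rw [φ.esymm_eq h0 hfin.toFinset (fun x hx => ((Set.Finite.mem_toFinset _).mp hx).1)
    (fun x hx h => (Set.Finite.mem_toFinset _).mpr ⟨hx, hR x h⟩)]
  exact ENNReal.ofReal_ne_top

theorem Config.esymm_zero {d : ℕ} {M : Type*} (φ : Config d M)
    (u : EuclideanSpace ℝ (Fin d) × M → ℝ) : φ.esymm u 0 = 1 := by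
  simp [Config.esymm, Config.sumDistinct_zero]

theorem measurable_prod_ofReal {d : ℕ} {M : Type*} [MeasurableSpace M]
    {u : EuclideanSpace ℝ (Fin d) × M → ℝ} (hu : Measurable u) (n : ℕ) :
    Measurable fun x : Fin n → EuclideanSpace ℝ (Fin d) × M => ∏ i, ENNReal.ofReal (u (x i)) :=
  Finset.measurable_fun_prod _ fun i _ =>
    ENNReal.measurable_ofReal.comp (hu.comp (measurable_pi_apply i))

section GenFun

universe u
variable {d : ℕ} {M : Type u} [TopologicalSpace M] [PolishSpace M] [MeasurableSpace M]
  [BorelSpace M]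

theorem measurable_esymm {u : EuclideanSpace ℝ (Fin d) × M → ℝ} (hu : Measurable u) (n : ℕ) :
    Measurable fun φ : Config d M => φ.esymm u n :=
  (measurable_sumDistinct_config (measurable_prod_ofReal hu n)).div_const _

/-- The generating functional as the alternating series of factorial moments, provided that this
series converges absolutely. -/
theorem hasSum_genFun (Q : Measure (Config d M))
    {u : EuclideanSpace ℝ (Fin d) × M → ℝ} (hu : Measurable u) (h0 : ∀ x, 0 ≤ u x) {R : ℝ}
    (hR : ∀ x, u x ≠ 0 → x ∈ Metric.closedBall (0 : EuclideanSpace ℝ (Fin d)) R ×ˢ univ)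
    (hfin : ∑' n, ∫⁻ φ, φ.esymm u n ∂Q ≠ ∞) :
    HasSum (fun n => (-1) ^ n * (∫⁻ φ, φ.esymm u n ∂Q).toReal) (genFun Q fun x => 1 - u x) := by
  have hn : ∀ n, ∫⁻ φ, φ.esymm u n ∂Q ≠ ∞ := ENNReal.ne_top_of_tsum_ne_top hfin
  have hint : ∀ n, ∫ φ, (φ.esymm u n).toReal ∂Q = (∫⁻ φ, φ.esymm u n ∂Q).toReal := fun n =>
    integral_toReal (measurable_esymm hu n).aemeasurable
      (ae_of_all _ fun φ => (φ.esymm_ne_top h0 hR n).lt_top)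
  have h := hasSum_integral_of_summable_integral_norm (μ := Q)
    (F := fun (n : ℕ) (φ : Config d M) => (-1) ^ n * (φ.esymm u n).toReal) (fun n =>
      (integrable_toReal_of_lintegral_ne_top (measurable_esymm hu n).aemeasurable
        (hn n)).const_mul _) ?_
  · simp_rw [integral_const_mul, hint, fun φ : Config d M => (φ.hasSum_esymm h0 hR).tsum_eq] at h
    exact h
  · simp only [norm_mul, norm_pow, norm_neg, norm_one, one_pow, one_mul, Real.norm_eq_abs,
      ENNReal.abs_toReal, hint]
    exact ENNReal.summable_toReal hfin

end GenFun

/-! ### Factorial moments of the empty space and nearest neighbour functions -/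

section Moments

universe u
variable {d : ℕ} {M : Type u}
  {ρ : ∀ n : ℕ, (Fin n → EuclideanSpace ℝ (Fin d) × M) → ℝ≥0} {D : Set M}

theorem uFun_nonneg (a : EuclideanSpace ℝ (Fin d)) (r : ℝ) (x : EuclideanSpace ℝ (Fin d) × M) :
    0 ≤ uFun ρ D a r x := by
  unfold uFun
  split_ifs <;> positivity

theorem uFun_le_one (a : EuclideanSpace ℝ (Fin d)) (r : ℝ) (x : EuclideanSpace ℝ (Fin d) × M) :
    uFun ρ D a r x ≤ 1 := by
  unfold uFun
  split_ifs with h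
  · exact div_le_one_of_le₀ (by exact_mod_cast lamBar_le_intensity ρ h.2) (NNReal.coe_nonneg _)
  · exact zero_le_one

theorem mem_of_uFun_ne_zero {a : EuclideanSpace ℝ (Fin d)} {r : ℝ}
    {x : EuclideanSpace ℝ (Fin d) × M} (h : uFun ρ D a r x ≠ 0) :
    x ∈ Metric.closedBall (0 : EuclideanSpace ℝ (Fin d)) (r + dist a 0) ×ˢ univ := by
  unfold uFun at h
  split_ifs at h with hx
  · exact ⟨Metric.closedBall_subset_closedBall' le_rfl hx.1, mem_univ _⟩
  · exact absurd rfl h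

variable [MeasurableSpace M]

theorem measurable_uFun (hm : ∀ n, Measurable (ρ n)) (hD : MeasurableSet D)
    (a : EuclideanSpace ℝ (Fin d)) (r : ℝ) : Measurable (uFun ρ D a r) := by
  unfold uFun
  exact Measurable.ite (Metric.isClosed_closedBall.measurableSet.prod hD)
    (measurable_const.div (measurable_coe_nnreal_real.comp (measurable_intensity ρ hm)))
    measurable_const

variable {ν : Measure M} [IsFiniteMeasure ν]

/-- Integration against products of `u_r^{a,D}` is integration over `(B(0,r) × D)^n` of the
translated and reweighted function. -/
theorem lintegral_prod_uFun (hm : ∀ n, Measurable (ρ n)) (hD : MeasurableSet D)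
    (a : EuclideanSpace ℝ (Fin d)) (r : ℝ) {n : ℕ}
    {h : (Fin n → EuclideanSpace ℝ (Fin d) × M) → ℝ≥0} (hh : Measurable h) :
    ∫⁻ y, (∏ i, ENNReal.ofReal (uFun ρ D a r (y i))) * h y
        ∂(Measure.pi fun _ => refMeasure d ν) =
      (lamBar ρ D : ℝ≥0∞) ^ n * ∫⁻ z, ((h (fun i => shift a (z i)) /
        ∏ i, intensity ρ (shift a (z i)) : ℝ≥0) : ℝ≥0∞) ∂(ballMeasure ν D r n) := by
  have hu := measurable_uFun hm hD a r
  have hball : MeasurableSet (Metric.closedBall (0 : EuclideanSpace ℝ (Fin d)) r ×ˢ D) :=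
    Metric.isClosed_closedBall.measurableSet.prod hD
  have hmem : ∀ x : EuclideanSpace ℝ (Fin d) × M, shift a x ∈ Metric.closedBall a r ×ˢ D ↔
      x ∈ Metric.closedBall (0 : EuclideanSpace ℝ (Fin d)) r ×ˢ D := by
    intro x
    simp [shift]
  have hF : Measurable fun y : Fin n → EuclideanSpace ℝ (Fin d) × M =>
      (∏ i, ENNReal.ofReal (uFun ρ D a r (y i))) * (h y : ℝ≥0∞) :=
    (Finset.measurable_fun_prod _ fun i _ => ENNReal.measurable_ofReal.comp
      (hu.comp (measurable_pi_apply i))).mul (measurable_coe_nnreal_ennreal.comp hh)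
  rw [← (measurePreserving_shift_pi ν a n).lintegral_comp hF, ballMeasure_eq,
    ← lintegral_const_mul' _ _ (ENNReal.pow_ne_top ENNReal.coe_ne_top),
    ← lintegral_indicator (MeasurableSet.univ_pi fun _ => hball)]
  refine lintegral_congr fun z => ?_
  by_cases hz : z ∈ univ.pi fun _ : Fin n =>
      (Metric.closedBall (0 : EuclideanSpace ℝ (Fin d)) r ×ˢ D)
  · rw [indicator_of_mem hz]
    have hui : ∀ i, ENNReal.ofReal (uFun ρ D a r (shift a (z i))) =
        ((lamBar ρ D / intensity ρ (shift a (z i)) : ℝ≥0) : ℝ≥0∞) := by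
      intro i
      rw [uFun, if_pos ((hmem _).mpr (hz i (mem_univ i))), ← NNReal.coe_div,
        ENNReal.ofReal_coe_nnreal]
    simp_rw [hui]
    norm_cast
    rw [Finset.prod_div_distrib, Finset.prod_const, Finset.card_univ, Fintype.card_fin,
      div_mul_eq_mul_div, mul_div_assoc]
  · rw [indicator_of_notMem hz]
    obtain ⟨i, hi⟩ : ∃ i, z i ∉ Metric.closedBall (0 : EuclideanSpace ℝ (Fin d)) r ×ˢ D := by
      by_contra! hc
      exact hz fun i _ => hc i
    rw [Finset.prod_eq_zero (Finset.mem_univ i), zero_mul]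
    rw [uFun, if_neg (fun h => hi ((hmem _).mp h)), ENNReal.ofReal_zero]

/-- The `n`-th term `λ̄_D^n / n! ∫ ρ^(n) / ∏ λ` of the series for the empty space function. -/
noncomputable def emptySpaceTerm (ν : Measure M)
    (ρ : ∀ n : ℕ, (Fin n → EuclideanSpace ℝ (Fin d) × M) → ℝ≥0) (D : Set M) (r : ℝ) (n : ℕ) :
    ℝ≥0∞ :=
  (lamBar ρ D : ℝ≥0∞) ^ n / n.factorial *
    ∫⁻ x, (reweighted ρ n x : ℝ≥0∞) ∂(ballMeasure ν D r n)

theorem lintegral_reweighted_ball_ne_top {Ω : Type*} [MeasurableSpace Ω] {P : Measure Ω}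
    {Y : Ω → Config d M} (hY : IsIRMS P Y ν ρ) (n : ℕ) (r : ℝ) :
    ∫⁻ x, (reweighted ρ n x : ℝ≥0∞) ∂(ballMeasure (d := d) ν D r n) ≠ ∞ := by
  refine ne_top_of_le_ne_top (lintegral_reweighted_ne_top hY n r) (lintegral_mono' ?_ le_rfl)
  rw [ballMeasure_eq, ballMeasure_eq]
  exact Measure.restrict_mono (pi_mono fun i _ => prod_mono subset_rfl (subset_univ _)) le_rfl

theorem emptySpaceTerm_ne_top {Ω : Type*} [MeasurableSpace Ω] {P : Measure Ω}
    {Y : Ω → Config d M} (hY : IsIRMS P Y ν ρ) (r : ℝ) (n : ℕ) :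
    emptySpaceTerm ν ρ D r n ≠ ∞ :=
  ENNReal.mul_ne_top (ENNReal.div_ne_top (ENNReal.pow_ne_top ENNReal.coe_ne_top)
    (by exact_mod_cast n.factorial_ne_zero)) (lintegral_reweighted_ball_ne_top hY n r)

/-- The root test; the terms with small `n` are finite by the moment assumption. -/
theorem tsum_emptySpaceTerm_ne_top {Ω : Type*} [MeasurableSpace Ω] {P : Measure Ω}
    {Y : Ω → Config d M} (hY : IsIRMS P Y ν ρ) {r : ℝ}
    (h : limsup (rootTerm ν ρ D r) atTop < 1) : ∑' n, emptySpaceTerm ν ρ D r n ≠ ∞ := by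
  obtain ⟨c, hc, hc1⟩ := exists_between h
  obtain ⟨N, hN⟩ := eventually_atTop.mp (eventually_lt_of_limsup_lt hc)
  -- The shift by `N + 1` also avoids `n = 0`, where `rootTerm` is the junk value `_ ^ 0 = 1`.
  have hle : ∀ n, emptySpaceTerm ν ρ D r (n + (N + 1)) ≤ c ^ n := by
    intro n
    have h0 : n + (N + 1) ≠ 0 := by omega
    have hroot : rootTerm ν ρ D r (n + (N + 1)) =
        emptySpaceTerm ν ρ D r (n + (N + 1)) ^ (1 / ((n + (N + 1) : ℕ) : ℝ)) := by
      unfold rootTerm emptySpaceTerm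
      simp_rw [reweighted_of_ne_zero ρ h0]
    have hlt := (hN (n + (N + 1)) (by omega)).le
    rw [hroot] at hlt
    have := pow_le_pow_left' hlt (n + (N + 1))
    rw [← ENNReal.rpow_natCast, ← ENNReal.rpow_mul, one_div,
      inv_mul_cancel₀ (by exact_mod_cast h0), ENNReal.rpow_one] at this
    exact this.trans (pow_le_pow_right_of_le_one' hc1.le (by omega))
  rw [← ENNReal.summable.sum_add_tsum_nat_add' (k := N + 1)]
  refine ENNReal.add_ne_top.mpr ⟨?_, ?_⟩
  · exact ENNReal.sum_ne_top.mpr fun n _ => emptySpaceTerm_ne_top hY r n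
  · refine ne_top_of_le_ne_top ?_ (ENNReal.tsum_le_tsum hle)
    rw [ENNReal.tsum_geometric]
    exact ENNReal.inv_ne_top.mpr (tsub_pos_of_lt hc1).ne'

theorem lintegral_reweighted_shift {Ω : Type*} [MeasurableSpace Ω] {P : Measure Ω}
    {Y : Ω → Config d M} (hY : IsIRMS P Y ν ρ) (a : EuclideanSpace ℝ (Fin d))
    (r : ℝ) (n : ℕ) :
    ∫⁻ z, (reweighted ρ n (fun i => shift a (z i)) : ℝ≥0∞) ∂(ballMeasure ν D r n) =
      ∫⁻ z, (reweighted ρ n z : ℝ≥0∞) ∂(ballMeasure (d := d) ν D r n) := by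
  rw [ballMeasure_eq]
  refine lintegral_congr_ae (ae_restrict_of_ae ?_)
  filter_upwards [ae_reweighted_shift hY n a] with z hz
  rw [hz]

variable [TopologicalSpace M] [PolishSpace M] [BorelSpace M]
  {Ω : Type*} [MeasurableSpace Ω] {P : Measure Ω} {Y : Ω → Config d M}

/-- By translation invariance of the reweighted product densities, the base point does not
matter. -/
theorem lintegral_esymm_map [IsProbabilityMeasure P] (hY : IsIRMS P Y ν ρ) (hD : MeasurableSet D)
    (a : EuclideanSpace ℝ (Fin d)) (r : ℝ) (n : ℕ) :
    ∫⁻ φ, φ.esymm (uFun ρ D a r) n ∂(P.map Y) = emptySpaceTerm ν ρ D r n := by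
  rcases Nat.eq_zero_or_pos n with rfl | hn
  · have := Measure.isProbabilityMeasure_map (μ := P) hY.measurable.aemeasurable
    simp only [Config.esymm_zero, emptySpaceTerm, reweighted_zero, ballMeasure]
    simp
  · have hm := hY.density.measurable
    have hu := measurable_uFun hm hD a r
    rw [lintegral_map (measurable_esymm hu n) hY.measurable]
    simp_rw [Config.esymm, div_eq_mul_inv]
    rw [lintegral_mul_const' _ _ (ENNReal.inv_ne_top.mpr (by exact_mod_cast n.factorial_ne_zero)),
      hY.density.campbell n hn _ (measurable_prod_ofReal hu n),
      lintegral_prod_uFun hm hD a r (hm n), emptySpaceTerm,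
      ← lintegral_reweighted_shift hY a r n, div_eq_mul_inv, mul_right_comm]
    simp_rw [reweighted_of_ne_zero ρ hn.ne']

/-- The series expansion of `1 - F`. -/
theorem hasSum_emptySpace [IsProbabilityMeasure P] (hY : IsIRMS P Y ν ρ) (hD : MeasurableSet D)
    (a : EuclideanSpace ℝ (Fin d)) {r : ℝ} (h : ∑' n, emptySpaceTerm ν ρ D r n ≠ ∞) :
    HasSum (fun n => (-1) ^ n * (emptySpaceTerm ν ρ D r n).toReal)
      (1 - Finhom P Y ρ D a r) := by
  have := hasSum_genFun (P.map Y) (measurable_uFun hY.density.measurable hD a r)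
    (uFun_nonneg a r) (fun x => mem_of_uFun_ne_zero) (by simpa only [lintegral_esymm_map hY hD])
  simpa only [lintegral_esymm_map hY hD, Finhom, sub_sub_cancel] using this

/-- The mixture over the marks `b ∈ C` of the reduced Palm measures `P^{!(a,b)}`. -/
noncomputable def palmMixture (ν : Measure M)
    (κ : Kernel (EuclideanSpace ℝ (Fin d) × M) (Config d M)) (C : Set M)
    (a : EuclideanSpace ℝ (Fin d)) : Measure (Config d M) :=
  κ.comap (fun b => (a, b)) measurable_prodMk_left ∘ₘ ν.restrict C

theorem palmGenFun_eq_genFun_palmMixture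
    (κ : Kernel (EuclideanSpace ℝ (Fin d) × M) (Config d M)) [IsMarkovKernel κ] (C : Set M)
    (a : EuclideanSpace ℝ (Fin d)) {u : EuclideanSpace ℝ (Fin d) × M → ℝ} (hu : Measurable u)
    (h0 : ∀ x, 0 ≤ u x) (h1 : ∀ x, u x ≤ 1) {R : ℝ}
    (hR : ∀ x, u x ≠ 0 → x ∈ Metric.closedBall (0 : EuclideanSpace ℝ (Fin d)) R ×ˢ univ) :
    palmGenFun ν κ C a (fun x => 1 - u x) =
      1 / ν.real C * genFun (palmMixture ν κ C a) fun x => 1 - u x := by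
  have hmeas : Measurable fun φ : Config d M => ∏ᶠ x ∈ φ.1, (1 - u x) := by
    refine measurable_of_tendsto_metrizable (f := fun N (φ : Config d M) =>
      ∑ n ∈ Finset.range N, (-1) ^ n * (φ.esymm u n).toReal) (fun N => ?_) ?_
    · exact Finset.measurable_fun_sum _ fun n _ =>
        (measurable_esymm hu n).ennreal_toReal.const_mul _
    · exact tendsto_pi_nhds.mpr fun φ => (φ.hasSum_esymm h0 hR).tendsto_sum_nat
  have hbound : ∀ φ : Config d M, ‖∏ᶠ x ∈ φ.1, (1 - u x)‖ ≤ 1 := by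
    intro φ
    refine finprod_mem_induction (fun y : ℝ => ‖y‖ ≤ 1) (by simp) (fun y z hy hz => ?_)
      fun x _ => ?_
    · rw [norm_mul]
      exact mul_le_one₀ hy (norm_nonneg _) hz
    · rw [Real.norm_eq_abs, abs_le]
      constructor <;> linarith [h0 x, h1 x]
  have : IsFiniteMeasure (palmMixture ν κ C a) := by unfold palmMixture; infer_instance
  have hint : Integrable (fun φ : Config d M => ∏ᶠ x ∈ φ.1, (1 - u x)) (palmMixture ν κ C a) :=
    .of_bound hmeas.aestronglyMeasurable 1 (ae_of_all _ hbound)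
  unfold palmGenFun genFun
  unfold palmMixture at hint ⊢
  rw [Measure.comp_eq_comp_const_apply] at hint ⊢
  rw [Kernel.integral_comp hint]
  simp

/-- The factorial moments of the Palm mixture, for almost every base point and all ranges at once. -/
theorem ae_lintegral_esymm_palmMixture (hY : IsIRMS P Y ν ρ)
    {κ : Kernel (EuclideanSpace ℝ (Fin d) × M) (Config d M)} [IsMarkovKernel κ]
    (hκ : IsReducedPalm P Y ν ρ κ) (C : Set M) {D : Set M} (hD : MeasurableSet D) :
    ∀ᵐ a : EuclideanSpace ℝ (Fin d), ∀ (r : ℝ) (n : ℕ),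
      ∫⁻ φ, φ.esymm (uFun ρ D a r) n ∂(palmMixture ν κ C a) =
        (lamBar ρ D : ℝ≥0∞) ^ n / n.factorial * ∫⁻ y, (reweighted ρ (n + 1)
          (Fin.cons (a, y.1) fun i => shift a (y.2 i)) : ℝ≥0∞)
            ∂((ν.restrict C).prod (ballMeasure ν D r n)) := by
  have hm := hY.density.measurable
  have hpos := intensity_pos hY.lamBar_pos
  filter_upwards [Measure.ae_ae_of_ae_prod (ae_forall_palm_sumDistinct hY hκ)] with a ha r n
  have hu := measurable_uFun hm hD a r
  have hcons : Measurable fun y : M × (Fin n → EuclideanSpace ℝ (Fin d) × M) =>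
      (reweighted ρ (n + 1) (Fin.cons (a, y.1) fun i => shift a (y.2 i)) : ℝ≥0∞) :=
    measurable_coe_nnreal_ennreal.comp ((measurable_reweighted ρ hm (n + 1)).comp
      ((measurable_cons n).comp ((measurePreserving_basePoint (0 : Measure M) n).measurable.comp
        measurable_prodMk_left)))
  unfold palmMixture
  rw [Measure.lintegral_bind (Kernel.aemeasurable _) (measurable_esymm hu n).aemeasurable,
    lintegral_prod _ hcons.aemeasurable, ← lintegral_const_mul _ hcons.lintegral_prod_right']
  refine lintegral_congr_ae (ae_restrict_of_ae ?_)
  filter_upwards [ha] with b hb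
  have h1 := hb n _ (measurable_prod_ofReal hu n)
  rw [lintegral_prod_uFun hm hD a r (h := fun y => ρ (n + 1) (Fin.cons (a, b) y))
    ((hm _).comp ((measurable_cons n).comp measurable_prodMk_left))] at h1
  have hne : (intensity ρ (a, b) : ℝ≥0∞) ≠ 0 := by exact_mod_cast (hpos _).ne'
  have h2 : ∀ z : Fin n → EuclideanSpace ℝ (Fin d) × M,
      ((ρ (n + 1) (Fin.cons (a, b) fun i => shift a (z i)) /
        ∏ i, intensity ρ (shift a (z i)) : ℝ≥0) : ℝ≥0∞) =
      reweighted ρ (n + 1) (Fin.cons (a, b) fun i => shift a (z i)) * intensity ρ (a, b) := by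
    intro z
    rw [← ENNReal.coe_mul, reweighted_of_ne_zero ρ n.succ_ne_zero, Fin.prod_univ_succ,
      Fin.cons_zero]
    simp_rw [Fin.cons_succ]
    rw [mul_comm (intensity ρ (a, b)), ← div_div, div_mul_cancel₀ _ (hpos _).ne']
  simp_rw [h2] at h1
  rw [lintegral_mul_const' _ _ ENNReal.coe_ne_top, ← mul_assoc,
    ENNReal.mul_left_inj hne ENNReal.coe_ne_top] at h1
  simp_rw [Kernel.comap_apply, Config.esymm, div_eq_mul_inv]
  rw [lintegral_mul_const' _ _ (ENNReal.inv_ne_top.mpr (by exact_mod_cast n.factorial_ne_zero)),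
    h1, mul_right_comm]

end Moments

/-! ### The factorisation of the Palm generating functional -/

/-- The correlation function of a single point is `1`, so the integral of order `0` is `ν(C)`. -/
theorem Jn_zero {d : ℕ} {M : Type*} [MeasurableSpace M] (ν : Measure M)
    (ρ : ∀ n : ℕ, (Fin n → EuclideanSpace ℝ (Fin d) × M) → ℝ≥0) (C D : Set M)
    (a : EuclideanSpace ℝ (Fin d)) (r : ℝ) : Jn ν ρ C D 0 a r = ν.real C := by
  have : ∀ y, Jintegrand ρ 0 a y = 1 := fun y => correlation_of_le_one ρ le_rfl _
  simp only [Jn, this, ballMeasure, integral_const, smul_eq_mul, mul_one, measureReal_def]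
  rw [← univ_prod_univ, Measure.prod_prod]
  simp

section Factorisation

variable {d : ℕ} {M : Type*} [MeasurableSpace M] {ν : Measure M} [IsFiniteMeasure ν]
  {ρ : ∀ n : ℕ, (Fin n → EuclideanSpace ℝ (Fin d) × M) → ℝ≥0} {C D : Set M}
  {Ω : Type*} [MeasurableSpace Ω] {P : Measure Ω} {Y : Ω → Config d M}

theorem integrable_reweighted_shift (hY : IsIRMS P Y ν ρ) (a : EuclideanSpace ℝ (Fin d)) (r : ℝ)
    (n : ℕ) : Integrable (fun z => (reweighted ρ n (fun i => shift a (z i)) : ℝ))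
      (ballMeasure ν D r n) := by
  refine ⟨(measurable_coe_nnreal_real.comp ((measurable_reweighted ρ hY.density.measurable n).comp
    (measurePreserving_shift_pi (0 : Measure M) a n).measurable)).aestronglyMeasurable, ?_⟩
  rw [hasFiniteIntegral_iff_enorm]
  simpa [lintegral_reweighted_shift hY] using (lintegral_reweighted_ball_ne_top hY n r).lt_top

theorem integral_reweighted_shift (hY : IsIRMS P Y ν ρ) (a : EuclideanSpace ℝ (Fin d)) (r : ℝ)
    (n : ℕ) : ∫ z, (reweighted ρ n (fun i => shift a (z i)) : ℝ) ∂(ballMeasure ν D r n) =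
      (∫⁻ z, (reweighted ρ n z : ℝ≥0∞) ∂(ballMeasure (d := d) ν D r n)).toReal := by
  rw [integral_eq_lintegral_of_nonneg_ae (ae_of_all _ fun _ => NNReal.coe_nonneg _)
    (integrable_reweighted_shift hY a r n).aestronglyMeasurable]
  simp_rw [ENNReal.ofReal_coe_nnreal, lintegral_reweighted_shift hY]

/-- Integrating the cluster expansion around a point at `a` with mark in `C`. -/
theorem integral_reweighted_cons (hY : IsIRMS P Y ν ρ) {a : EuclideanSpace ℝ (Fin d)} {r : ℝ}
    (ha : ∀ n, Integrable (Jintegrand ρ n a) ((ν.restrict C).prod (ballMeasure ν D r n)))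
    (n : ℕ) :
    Integrable (fun y => (reweighted ρ (n + 1) (Fin.cons (a, y.1) fun i => shift a (y.2 i)) : ℝ))
        ((ν.restrict C).prod (ballMeasure ν D r n)) ∧
    ∫ y, (reweighted ρ (n + 1) (Fin.cons (a, y.1) fun i => shift a (y.2 i)) : ℝ)
        ∂((ν.restrict C).prod (ballMeasure ν D r n)) =
      ∑ T : Finset (Fin n), Jn ν ρ C D T.card a r *
        (∫⁻ z, (reweighted ρ Tᶜ.card z : ℝ≥0∞) ∂(ballMeasure (d := d) ν D r Tᶜ.card)).toReal := by
  have hT : ∀ T : Finset (Fin n), Integrable (fun y : M × (Fin n → EuclideanSpace ℝ (Fin d) × M) =>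
      Jintegrand ρ T.card a (y.1, fun j => y.2 (T.orderEmbOfFin rfl j)) *
        (reweighted ρ Tᶜ.card fun j => shift a (y.2 (Tᶜ.orderEmbOfFin rfl j)) : ℝ))
      ((ν.restrict C).prod (ballMeasure ν D r n)) := fun T =>
    integrable_mul_coords T (ha T.card) (integrable_reweighted_shift hY a r Tᶜ.card)
  have hexp : ∀ y : M × (Fin n → EuclideanSpace ℝ (Fin d) × M),
      (reweighted ρ (n + 1) (Fin.cons (a, y.1) fun i => shift a (y.2 i)) : ℝ) =
      ∑ T : Finset (Fin n), Jintegrand ρ T.card a (y.1, fun j => y.2 (T.orderEmbOfFin rfl j)) *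
        (reweighted ρ Tᶜ.card fun j => shift a (y.2 (Tᶜ.orderEmbOfFin rfl j)) : ℝ) := fun y =>
    reweighted_cons ρ (intensity_pos hY.lamBar_pos) n _ _
  simp_rw [hexp]
  refine ⟨integrable_finsetSum _ fun T _ => hT T, ?_⟩
  rw [integral_finsetSum _ fun T _ => hT T]
  refine Finset.sum_congr rfl fun T _ => ?_
  rw [← integral_reweighted_shift hY a r Tᶜ.card]
  exact integral_mul_coords T (ha T.card) (integrable_reweighted_shift hY a r Tᶜ.card)

/-- Dividing by `n!` turns the sum over subsets of `{1, …, n}` into a Cauchy product. -/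
theorem factorial_smul_sum_finset (c : ℝ) (f g : ℕ → ℝ) (n : ℕ) :
    c ^ n / n.factorial * ∑ T : Finset (Fin n), f T.card * g Tᶜ.card =
      ∑ p ∈ Finset.HasAntidiagonal.antidiagonal n,
        (c ^ p.1 / p.1.factorial * f p.1) * (c ^ p.2 / p.2.factorial * g p.2) := by
  have h1 : ∑ T : Finset (Fin n), f T.card * g Tᶜ.card =
      ∑ p ∈ Finset.HasAntidiagonal.antidiagonal n, (n.choose p.1 : ℝ) * (f p.1 * g p.2) := by
    rw [Finset.Nat.sum_antidiagonal_eq_sum_range_succ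
      (fun k l => (n.choose k : ℝ) * (f k * g l)), ← Finset.powerset_univ]
    have := Finset.sum_powerset_apply_card (fun k => f k * g (n - k))
      (x := (Finset.univ : Finset (Fin n)))
    simp only [Finset.card_univ, Fintype.card_fin, nsmul_eq_mul] at this
    rw [← this]
    refine Finset.sum_congr rfl fun T _ => ?_
    rw [Finset.card_compl, Fintype.card_fin]
  rw [h1, Finset.mul_sum]
  refine Finset.sum_congr rfl fun p hp => ?_
  obtain ⟨k, l⟩ := p
  obtain rfl : k + l = n := Finset.HasAntidiagonal.mem_antidiagonal.mp hp
  have hfac : ((k + l).factorial : ℝ) = (k + l).choose k * k.factorial * l.factorial := by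
    have := Nat.add_choose_mul_factorial_mul_factorial l k
    rw [add_comm l k] at this
    rw [← this]
    push_cast
    ring
  have hk : (k.factorial : ℝ) ≠ 0 := by exact_mod_cast k.factorial_ne_zero
  have hl : (l.factorial : ℝ) ≠ 0 := by exact_mod_cast l.factorial_ne_zero
  have hc : ((k + l).choose k : ℝ) ≠ 0 := by
    exact_mod_cast (Nat.choose_pos (Nat.le_add_right k l)).ne'
  simp only [hfac, pow_add]
  field_simp

end Factorisation

end MarkedPP

/-! ### Constancy of `J_n` and the representation of the `J`-function -/

theorem theorem1 {d : ℕ} {M : Type*} [TopologicalSpace M] [PolishSpace M] [MeasurableSpace M]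
    [BorelSpace M] (ν : Measure M) [IsFiniteMeasure ν]
    {Ω : Type*} [MeasurableSpace Ω] (P : Measure Ω) [IsProbabilityMeasure P]
    (Y : Ω → Config d M)
    (ρ : ∀ n : ℕ, (Fin n → EuclideanSpace ℝ (Fin d) × M) → ℝ≥0)
    (hY : IsIRMS P Y ν ρ)
    (κ : Kernel (EuclideanSpace ℝ (Fin d) × M) (Config d M)) [IsMarkovKernel κ]
    (hκ : IsReducedPalm P Y ν ρ κ)
    (C D : Set M) (hC : MeasurableSet C) (hD : MeasurableSet D) (hνC : 0 < ν C) (hνD : 0 < ν D) :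
    (∀ n : ℕ, 1 ≤ n → ∀ r : ℝ, 0 ≤ r → ∃ c : ℝ, ∀ᵐ a : EuclideanSpace ℝ (Fin d),
      Integrable (Jintegrand ρ n a) ((ν.restrict C).prod (ballMeasure ν D r n)) ∧
        Jn ν ρ C D n a r = c) ∧
    (∀ᵐ a : EuclideanSpace ℝ (Fin d), ∀ r : ℝ, 0 ≤ r →
      limsup (rootTerm ν ρ D r) atTop < 1 → JConverges ν ρ C D a r →
      ∀ a' : EuclideanSpace ℝ (Fin d), Finhom P Y ρ D a' r ≠ 1 →
        Jinhom ν ρ C D a r = (1 - Dinhom ν ρ κ C D a r) / (1 - Finhom P Y ρ D a' r)) := by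
  refine ⟨fun n hn r _ => ?_, ?_⟩
  · obtain ⟨c, hc⟩ := ae_Jn_eq_const hY (C := C) (D := D) n hn r
    refine ⟨c, ?_⟩
    filter_upwards [ae_integrable_Jintegrand hY, hc] with a ha hca
    exact ⟨ha n r C D, hca⟩
  filter_upwards [ae_integrable_Jintegrand hY, ae_lintegral_esymm_palmMixture hY hκ C hD]
    with a ha hpalm r _ hlim hconv a' hF
  have hfin := tsum_emptySpaceTerm_ne_top hY hlim
  set L : ℝ := (lamBar ρ D : ℝ) with hL
  set R : ℕ → ℝ := fun n =>
    (∫⁻ z, (reweighted ρ n z : ℝ≥0∞) ∂(ballMeasure (d := d) ν D r n)).toReal with hR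
  set J : ℕ → ℝ := fun n => Jn ν ρ C D n a r with hJ
  have hterm : ∀ n, (emptySpaceTerm ν ρ D r n).toReal = L ^ n / n.factorial * R n := by
    intro n
    simp [emptySpaceTerm, hL, hR]
  -- The factorial moments of the Palm mixture are the Cauchy product of two convergent series.
  have hmom : ∀ n, ∫⁻ φ, φ.esymm (uFun ρ D a r) n ∂(palmMixture ν κ C a) =
      ENNReal.ofReal (∑ p ∈ Finset.HasAntidiagonal.antidiagonal n,
        (L ^ p.1 / p.1.factorial * J p.1) * (L ^ p.2 / p.2.factorial * R p.2)) := by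
    intro n
    obtain ⟨hi, hi'⟩ := integral_reweighted_cons hY (fun n => ha n r C D) n
    rw [hpalm, ← factorial_smul_sum_finset, ← hi', ENNReal.ofReal_mul (by positivity),
      ofReal_integral_eq_lintegral_ofReal hi (ae_of_all _ fun _ => NNReal.coe_nonneg _)]
    simp_rw [ENNReal.ofReal_coe_nnreal]
    rw [ENNReal.ofReal_div_of_pos (by exact_mod_cast n.factorial_pos),
      ENNReal.ofReal_pow (NNReal.coe_nonneg _), ENNReal.ofReal_coe_nnreal, ENNReal.ofReal_natCast]
  have hJsum : Summable fun n => ‖L ^ n / n.factorial * J n‖ := by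
    refine (summable_nat_add_iff 1).mp (hconv.congr fun n => ?_)
    rw [Jterm, Real.norm_eq_abs, abs_mul, abs_mul, abs_div, abs_div, abs_pow, abs_pow, abs_neg]
  have hRsum : Summable fun n => ‖L ^ n / n.factorial * R n‖ := by
    simp_rw [← hterm]
    exact (ENNReal.summable_toReal hfin).norm
  have hprod := summable_norm_sum_mul_antidiagonal_of_summable_norm hJsum hRsum
  -- The Palm moments are nonnegative, so their sum is bounded by that of the absolute values of the
  -- Cauchy product, although the `J_n` may change sign.
  have hpfin : ∑' n, ∫⁻ φ, φ.esymm (uFun ρ D a r) n ∂(palmMixture ν κ C a) ≠ ∞ := by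
    refine ne_top_of_le_ne_top ?_ (ENNReal.tsum_le_tsum fun n =>
      (hmom n).le.trans (ENNReal.ofReal_le_ofReal (Real.le_norm_self _)))
    exact hprod.tsum_ofReal_ne_top
  have hnonneg : ∀ n, 0 ≤ ∑ p ∈ Finset.HasAntidiagonal.antidiagonal n,
        (L ^ p.1 / p.1.factorial * J p.1) * (L ^ p.2 / p.2.factorial * R p.2) := by
    intro n
    rw [← factorial_smul_sum_finset, ← (integral_reweighted_cons hY (fun n => ha n r C D) n).2]
    exact mul_nonneg (by positivity) (integral_nonneg fun _ => NNReal.coe_nonneg _)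
  have hG := (hasSum_genFun (palmMixture ν κ C a) (measurable_uFun hY.density.measurable hD a r)
    (uFun_nonneg a r) (fun x => mem_of_uFun_ne_zero) hpfin).tsum_eq
  have hE := (hasSum_emptySpace hY hD a' hfin).tsum_eq
  simp_rw [hterm] at hE
  have hsign : ∀ n, (-1 : ℝ) ^ n * (∫⁻ φ, φ.esymm (uFun ρ D a r) n ∂(palmMixture ν κ C a)).toReal =
      ∑ p ∈ Finset.HasAntidiagonal.antidiagonal n, Jterm ν ρ C D a r p.1 *
        ((-1) ^ p.2 * (L ^ p.2 / p.2.factorial * R p.2)) := by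
    intro n
    rw [hmom, ENNReal.toReal_ofReal (hnonneg n), Finset.mul_sum]
    refine Finset.sum_congr rfl fun p hp => ?_
    rw [← Finset.HasAntidiagonal.mem_antidiagonal.mp hp, pow_add, Jterm, neg_pow (lamBar ρ D : ℝ)]
    ring
  have hJ' : Summable fun n => ‖Jterm ν ρ C D a r n‖ :=
    (summable_nat_add_iff 1).mp hconv
  have hR' : Summable fun n => ‖(-1 : ℝ) ^ n * (L ^ n / n.factorial * R n)‖ := by
    simpa [norm_mul] using hRsum
  have hfac : genFun (palmMixture ν κ C a) (fun x => 1 - uFun ρ D a r x) =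
      (∑' n, Jterm ν ρ C D a r n) * (1 - Finhom P Y ρ D a' r) := by
    rw [← hG, ← hE, tsum_mul_tsum_eq_tsum_sum_antidiagonal_of_summable_norm hJ' hR']
    exact tsum_congr hsign
  -- Since `J_0 = ν(C)`, the constant in the definition of `J` is the term of index `0`.
  have hJ0 : Jinhom ν ρ C D a r = 1 / ν.real C * ∑' n, Jterm ν ρ C D a r n := by
    rw [hJ'.of_norm.tsum_eq_zero_add, Jinhom]
    congr 2
    simp [Jterm, Jn_zero]
  have hF' : 1 - Finhom P Y ρ D a' r ≠ 0 := sub_ne_zero.mpr (Ne.symm hF)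
  rw [eq_div_iff hF', hJ0, Dinhom, sub_sub_cancel, palmGenFun_eq_genFun_palmMixture κ C a
    (measurable_uFun hY.density.measurable hD a r) (uFun_nonneg a r) (uFun_le_one a r)
    (fun x => mem_of_uFun_ne_zero), hfac, mul_assoc]
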